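/- Let $(M,g)$ be a connected, oriented and time-oriented smooth Lorentzian manifold of dimension $m$ (Hausdorff, second countable, $g$ smooth of signature $(-,+,\dots,+)$), let $k\in\{1,\dots,m\}$ and $p\in M$. Let $\mathrm{Hol}_p\subset GL(T_pM)$ be the holonomy group of the Levi-Civita connection of $g$, i.e. the group of parallel transports along piecewise smooth loops at $p$. Embed $SO(m-k)$ in $GL(m,\mathbb{R})$ as the group of block diagonal matrices $\mathrm{diag}(I_k,A)$, $A\in SO(m-k)$. Then $\mathrm{Hol}\subset SO(m-k)$, in the sense that in some basis of $T_pM$ all elements of $\mathrm{Hol}_p$ have matrices in $SO(m-k)$, if and only if $M$ admits smooth parallel vector fields $V_1,\dots,V_k$ (that is, $\nabla V_i=0$) with $|g(V_i,V_i)|=1$ for all $i$, $g(V_i,V_j)=0$ for $i\neq j$, and $V_1$ timelike ($g(V_1,V_1)<0$). The equivalence also holds if $\mathrm{Hol}\subset SO(m-k)$ is understood in the stricter sense that the basis of $T_pM$ can be chosen $g$-orthonormal with timelike first vector. -/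

import Mathlib

open Bundle Manifold Set Topology
open scoped ContDiff

noncomputable section

namespace Lorentzian

/-- A Lorentzian metric on the `m`-dimensional manifold `M`: a smooth symmetric bilinear form on
the tangent spaces, each of which has an orthonormal basis with exactly one vector of square `-1`,
all others having square `1`. -/
structure LorentzianMetric (m : ℕ) (M : Type*) [TopologicalSpace M]
    [ChartedSpace (EuclideanSpace ℝ (Fin m)) M] [IsManifold (𝓡 m) ∞ M] where
  /-- the bilinear form on each tangent space -/
  val : ∀ x : M, TangentSpace (𝓡 m) x →L[ℝ] TangentSpace (𝓡 m) x →L[ℝ] ℝ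
  symm : ∀ (x : M) (v w : TangentSpace (𝓡 m) x), val x v w = val x w v
  signature : ∀ x : M, ∃ b : Module.Basis (Fin m) ℝ (TangentSpace (𝓡 m) x),
    ∀ i j, val x (b i) (b j) = if i = j then (if (i : ℕ) = 0 then -1 else 1) else 0
  contMDiff : ContMDiff (𝓡 m)
    ((𝓡 m).prod 𝓘(ℝ, EuclideanSpace ℝ (Fin m) →L[ℝ] EuclideanSpace ℝ (Fin m) →L[ℝ] ℝ)) ∞
    (fun x ↦ TotalSpace.mk' (EuclideanSpace ℝ (Fin m) →L[ℝ] EuclideanSpace ℝ (Fin m) →L[ℝ] ℝ)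
      (E := fun x : M ↦ TangentSpace (𝓡 m) x →L[ℝ] TangentSpace (𝓡 m) x →L[ℝ] ℝ) x (val x))

variable {m : ℕ} {M : Type*} [TopologicalSpace M]
  [ChartedSpace (EuclideanSpace ℝ (Fin m)) M] [IsManifold (𝓡 m) ∞ M]

/-! ### Orientations and time orientations -/

/-- A family of orientations of the tangent spaces is an orientation of the manifold if around
every point there is a continuous local frame that is positively oriented. -/
def IsOrientation (o : ∀ x : M, _root_.Orientation ℝ (TangentSpace (𝓡 m) x) (Fin m)) : Prop :=
  ∀ x₀ : M, ∃ U ∈ 𝓝 x₀, ∃ e : Fin m → ∀ x : M, TangentSpace (𝓡 m) x,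
    (∀ i, ContinuousOn (fun x ↦ (⟨x, e i x⟩ : TangentBundle (𝓡 m) M)) U) ∧
    ∀ x ∈ U, ∃ b : Module.Basis (Fin m) ℝ (TangentSpace (𝓡 m) x),
      (∀ i, b i = e i x) ∧ b.orientation = o x

/-- A family `C` of subsets of the tangent spaces is a time orientation (the family of future
timecones) if around every point there is a continuous timelike vector field `T` such that `C x`
is the timecone containing `T x`. -/
def IsTimeOrientation (g : LorentzianMetric m M) (C : ∀ x : M, Set (TangentSpace (𝓡 m) x)) :
    Prop :=
  ∀ x₀ : M, ∃ U ∈ 𝓝 x₀, ∃ T : ∀ x : M, TangentSpace (𝓡 m) x,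
    ContinuousOn (fun x ↦ (⟨x, T x⟩ : TangentBundle (𝓡 m) M)) U ∧
    ∀ x ∈ U, g.val x (T x) (T x) < 0 ∧ C x = {v | g.val x v v < 0 ∧ g.val x v (T x) < 0}

/-! ### The Levi-Civita connection in charts -/

/-- The metric in the chart around `x`: the pullback of `g` under the inverse chart, as a function
of the coordinate `y`. -/
def chartMetric (g : LorentzianMetric m M) (x : M) (y : EuclideanSpace ℝ (Fin m)) :
    EuclideanSpace ℝ (Fin m) →L[ℝ] EuclideanSpace ℝ (Fin m) →L[ℝ] ℝ :=
  let B : EuclideanSpace ℝ (Fin m) →L[ℝ] EuclideanSpace ℝ (Fin m) →L[ℝ] ℝ :=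
    g.val ((extChartAt (𝓡 m) x).symm y)
  let A : EuclideanSpace ℝ (Fin m) →L[ℝ] EuclideanSpace ℝ (Fin m) :=
    mfderiv 𝓘(ℝ, EuclideanSpace ℝ (Fin m)) (𝓡 m) (extChartAt (𝓡 m) x).symm y
  B.bilinearComp A A

/-- The Christoffel symbols (of the second kind) of `g` in the chart around `x` at the coordinate
`y`: with `G` the metric in that chart, `Γ(v, w)` is the vector determined by
`2 G(Γ(v, w), z) = (D_v G)(w, z) + (D_w G)(v, z) - (D_z G)(v, w)` for all `z`. -/
def christoffel (g : LorentzianMetric m M) (x : M) (y v w : EuclideanSpace ℝ (Fin m)) :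
    EuclideanSpace ℝ (Fin m) :=
  (chartMetric g x y).inverse ((1 / 2 : ℝ) •
    (fderiv ℝ (chartMetric g x) y v w + fderiv ℝ (chartMetric g x) y w v
      - ((fderiv ℝ (chartMetric g x) y).flip v).flip w))

/-- The components of a tangent vector `v` at `z` in the chart around `x`. -/
def chartVector (x : M) {z : M} (v : TangentSpace (𝓡 m) z) : EuclideanSpace ℝ (Fin m) :=
  mfderiv (𝓡 m) 𝓘(ℝ, EuclideanSpace ℝ (Fin m)) (extChartAt (𝓡 m) x) z v

/-- The components, in the chart around `x`, of the covariant derivative `∇_v V` at `x` of a vector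
field `V` in the direction whose components are `v`. -/
def covDeriv (g : LorentzianMetric m M) (V : ∀ x : M, TangentSpace (𝓡 m) x) (x : M)
    (v : EuclideanSpace ℝ (Fin m)) : EuclideanSpace ℝ (Fin m) :=
  fderiv ℝ (fun y ↦ chartVector x (V ((extChartAt (𝓡 m) x).symm y))) (extChartAt (𝓡 m) x x) v
    + christoffel g x (extChartAt (𝓡 m) x x) v (chartVector x (V x))

/-- A smooth vector field `V` with `∇V = 0`. -/
def IsParallelField (g : LorentzianMetric m M) (V : ∀ x : M, TangentSpace (𝓡 m) x) : Prop :=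
  ContMDiff (𝓡 m) (𝓡 m).tangent ∞ (fun x ↦ (⟨x, V x⟩ : TangentBundle (𝓡 m) M)) ∧
    ∀ (x : M) (v : EuclideanSpace ℝ (Fin m)), covDeriv g V x v = 0

/-! ### Parallel transport and holonomy -/

/-- A vector field `X` along the curve `γ : [0, 1] → M` is parallel: at every time `t`, in the chart
around `γ t`, its components satisfy `X' = - Γ(γ', X)`. -/
def IsParallelAlong (g : LorentzianMetric m M) (γ : ℝ → M)
    (X : ∀ t : ℝ, TangentSpace (𝓡 m) (γ t)) : Prop :=
  ∀ t ∈ Icc (0 : ℝ) 1,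
    HasDerivWithinAt (fun s ↦ chartVector (γ t) (X s))
      (-christoffel g (γ t) (extChartAt (𝓡 m) (γ t) (γ t))
        (derivWithin (fun s ↦ extChartAt (𝓡 m) (γ t) (γ s)) (Icc 0 1) t)
        (chartVector (γ t) (X t)))
      (Icc 0 1) t

/-- `IsParallelTransport g P`, for a linear map `P : T_pM → T_qM`, says that `P` is the parallel
transport along some piecewise smooth curve from `p` to `q`. A piecewise smooth curve is a finite
concatenation of smooth curves, and the parallel transport along a concatenation is the composition
of the parallel transports along the pieces. -/
inductive IsParallelTransport (g : LorentzianMetric m M) :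
    ∀ {p q : M}, (TangentSpace (𝓡 m) p →ₗ[ℝ] TangentSpace (𝓡 m) q) → Prop
  | smooth {p q : M} (P : TangentSpace (𝓡 m) p →ₗ[ℝ] TangentSpace (𝓡 m) q) (γ : ℝ → M)
      (smooth : ContMDiffOn 𝓘(ℝ, ℝ) (𝓡 m) ∞ γ (Icc 0 1))
      (source : γ 0 = p) (target : γ 1 = q)
      (transport : ∀ v : TangentSpace (𝓡 m) p, ∃ X : ∀ t : ℝ, TangentSpace (𝓡 m) (γ t),
        IsParallelAlong g γ X ∧
        (⟨γ 0, X 0⟩ : TangentBundle (𝓡 m) M) = ⟨p, v⟩ ∧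
        (⟨γ 1, X 1⟩ : TangentBundle (𝓡 m) M) = ⟨q, P v⟩) : IsParallelTransport g P
  | comp {p q r : M} (P : TangentSpace (𝓡 m) p →ₗ[ℝ] TangentSpace (𝓡 m) q)
      (Q : TangentSpace (𝓡 m) q →ₗ[ℝ] TangentSpace (𝓡 m) r)
      (hP : IsParallelTransport g P) (hQ : IsParallelTransport g Q) :
      IsParallelTransport g (Q ∘ₗ P)

/-- The holonomy group at `p` (as a set of endomorphisms of `T_pM`): all parallel transports along
piecewise smooth loops at `p`. -/
def Hol (g : LorentzianMetric m M) (p : M) :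
    Set (TangentSpace (𝓡 m) p →ₗ[ℝ] TangentSpace (𝓡 m) p) :=
  {P | IsParallelTransport g P}

/-- In the basis `b` of `T_pM`, the holonomy group at `p` is contained in `SO(n)`, embedded in
`GL(k + n)` as the group of block diagonal matrices `diag(1, A)` with `A ∈ SO(n)`. -/
def HolInSO (g : LorentzianMetric m M) (p : M) {k n : ℕ}
    (b : Module.Basis (Fin k ⊕ Fin n) ℝ (TangentSpace (𝓡 m) p)) : Prop :=
  ∀ P ∈ Hol g p, ∃ A ∈ Matrix.specialOrthogonalGroup (Fin n) ℝ,
    LinearMap.toMatrix b b P = Matrix.fromBlocks 1 0 0 A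

/-- An orthonormal system of vectors at `x`. -/
def IsOrthonormalAt (g : LorentzianMetric m M) (x : M) {ι : Type*}
    (e : ι → TangentSpace (𝓡 m) x) : Prop :=
  (∀ i, |g.val x (e i) (e i)| = 1) ∧ ∀ i j, i ≠ j → g.val x (e i) (e j) = 0

/-- A vector `v` at `x` is timelike. -/
def IsTimelike (g : LorentzianMetric m M) (x : M) (v : TangentSpace (𝓡 m) x) : Prop :=
  g.val x v v < 0

/-- `V₁, …, V_k` are parallel vector fields forming an orthonormal system at every point, and `V₁`
is timelike. -/
def IsParallelOrthonormalSystem (g : LorentzianMetric m M) {k : ℕ} (hk : 1 ≤ k)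
    (V : Fin k → ∀ x : M, TangentSpace (𝓡 m) x) : Prop :=
  (∀ i, IsParallelField g (V i)) ∧
    (∀ x, IsOrthonormalAt g x (fun i ↦ V i x)) ∧
    ∀ x, IsTimelike g x (V ⟨0, hk⟩ x)

end Lorentzian

end

/-!
# Holonomy in `SO(m - k)` and parallel orthonormal systems

The equivalence is the correspondence between parallel fields and vectors fixed by the holonomy
group, together with some Lorentzian linear algebra that produces and uses timelike vectors.

*From parallel fields to holonomy.* Parallel transport is isometric, because the inner product of
two parallel fields along a curve is constant (`IsParallelAlong.val_eq`). It maps the values of a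
parallel vector field to each other (`IsParallelTransport.apply_field`), and it preserves the
orientation and the time orientation, since these can only change discontinuously along a curve
(`IsParallelTransport.map_orientation`, `IsParallelTransport.mem_cone`). Given `V₁, …, V_k`, the
orthogonal complement of their values at `p` is spacelike since `V₁` is timelike; an orthonormal
basis of it completes them to a basis in which a holonomy has the matrix `diag(1, A)`, with `A`
orthogonal and of positive determinant (`exists_specialOrthogonal_of_isometry`).

*From holonomy to parallel fields.* In the given basis, which need not be related to `g`, the
holonomies fix the first `k` vectors and preserve the Euclidean norm. The vectors of square at most
`-1` in one timecone at `p` form a closed convex set, preserved by the holonomies; its element of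
least Euclidean norm is unique, so it is fixed by them (`exists_timelike_fixed`). The fixed vectors
thus form a space of dimension at least `k` that contains a timelike vector, and this space contains
an orthonormal system of `k` vectors with timelike first vector. A fixed vector extends, by parallel
transport, to a vector field invariant under all transports (`exists_transport_invariant_field`).

*Existence and regularity.* Transport along short segments in a chart is obtained from the
Picard-Lindelöf theorem. Parallelism along a curve is defined at each time in the chart around that
point of the curve, so solutions in one fixed chart are compared with it through the transformation
law of the Christoffel symbols (`christoffel_chartChange`). A field `ξ` that is invariant under
transport satisfies `ξ' = -Γ(v, ξ)` along all segments of a small ball. It is therefore bounded by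
Grönwall's inequality, hence continuous, hence differentiable with derivative `-Γ(·, ξ)`, and this
formula for the derivative makes it smooth (`SolvesAlongSegments.contDiffOn`); no smooth dependence
of solutions on parameters is needed.
-/

noncomputable section

namespace Lorentzian

set_option linter.unusedSectionVars false
set_option maxSynthPendingDepth 3

/-! ### Tangent vectors in charts -/

section Charts

variable {m : ℕ} {M : Type*} [TopologicalSpace M]
  [ChartedSpace (EuclideanSpace ℝ (Fin m)) M] [IsManifold (𝓡 m) ∞ M]

local notation "Em" => EuclideanSpace ℝ (Fin m)

/-- The tangent vector at the point with coordinate `y` in the chart around `x` whose components in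
that chart are given; the inverse of `chartVector`. -/
def coordVector (x : M) (y : Em) : Em →L[ℝ] TangentSpace (𝓡 m) ((extChartAt (𝓡 m) x).symm y) :=
  mfderiv 𝓘(ℝ, Em) (𝓡 m) (extChartAt (𝓡 m) x).symm y

/-- `chartVector` as a continuous linear map. -/
def chartVectorL (x z : M) : TangentSpace (𝓡 m) z →L[ℝ] Em :=
  mfderiv (𝓡 m) 𝓘(ℝ, Em) (extChartAt (𝓡 m) x) z

lemma chartVectorL_apply (x : M) {z : M} (v : TangentSpace (𝓡 m) z) :
    chartVectorL x z v = chartVector x v := rfl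

lemma isManifold_one : IsManifold (𝓡 m) 1 M := IsManifold.of_le (n := ∞) (by norm_cast)

lemma coordVector_eq (x : M) (y : Em) :
    coordVector x y = mfderivWithin 𝓘(ℝ, Em) (𝓡 m) (extChartAt (𝓡 m) x).symm (range (𝓡 m)) y := by
  unfold coordVector
  rw [modelWithCornersSelf_coe, range_id, mfderivWithin_univ]

lemma isOpen_chartTarget (x : M) : IsOpen (extChartAt (𝓡 m) x).target :=
  isOpen_extChartAt_target x

@[simp]
lemma chartVector_coordVector (x : M) {y : Em} (hy : y ∈ (extChartAt (𝓡 m) x).target) (w : Em) :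
    chartVector x (coordVector x y w) = w := by
  have := isManifold_one (m := m) (M := M)
  have h := mfderiv_extChartAt_comp_mfderivWithin_extChartAt_symm (I := 𝓡 m) hy
  rw [← coordVector_eq] at h
  exact congrArg (fun f : Em →L[ℝ] Em ↦ f w) h

@[simp]
lemma coordVector_chartVector (x : M) {y : Em} (hy : y ∈ (extChartAt (𝓡 m) x).target)
    (v : TangentSpace (𝓡 m) ((extChartAt (𝓡 m) x).symm y)) :
    coordVector x y (chartVector x v) = v := by
  have := isManifold_one (m := m) (M := M)
  have h := mfderivWithin_extChartAt_symm_comp_mfderiv_extChartAt (I := 𝓡 m) hy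
  rw [← coordVector_eq] at h
  exact congrArg (fun f : Em →L[ℝ] Em ↦ f v) h

lemma exists_coord_of_mem_source {x z : M} (hz : z ∈ (extChartAt (𝓡 m) x).source) :
    ∃ y ∈ (extChartAt (𝓡 m) x).target, (extChartAt (𝓡 m) x).symm y = z :=
  ⟨_, (extChartAt (𝓡 m) x).map_source hz, (extChartAt (𝓡 m) x).left_inv hz⟩

/-- The components of tangent vectors at a point of the chart domain, as a linear equivalence. -/
def chartVectorEquiv (x : M) {z : M} (hz : z ∈ (extChartAt (𝓡 m) x).source) :
    TangentSpace (𝓡 m) z ≃ₗ[ℝ] Em :=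
  LinearEquiv.ofBijective (chartVectorL x z).toLinearMap (by
    obtain ⟨y, hy, rfl⟩ := exists_coord_of_mem_source hz
    exact ⟨Function.LeftInverse.injective (g := coordVector x y) (coordVector_chartVector x hy),
      Function.RightInverse.surjective (g := coordVector x y) (chartVector_coordVector x hy)⟩)

@[simp]
lemma chartVectorEquiv_apply (x : M) {z : M} (hz : z ∈ (extChartAt (𝓡 m) x).source)
    (v : TangentSpace (𝓡 m) z) : chartVectorEquiv x hz v = chartVector x v := rfl

lemma chartMetric_apply (g : LorentzianMetric m M) (x : M) (y v w : Em) :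
    chartMetric g x y v w =
      g.val ((extChartAt (𝓡 m) x).symm y) (coordVector x y v) (coordVector x y w) := rfl

lemma chartMetric_chartVector (g : LorentzianMetric m M) {x z : M}
    (hz : z ∈ (extChartAt (𝓡 m) x).source) (v w : TangentSpace (𝓡 m) z) :
    chartMetric g x (extChartAt (𝓡 m) x z) (chartVector x v) (chartVector x w) = g.val z v w := by
  obtain ⟨y, hy, rfl⟩ := exists_coord_of_mem_source hz
  rw [(extChartAt (𝓡 m) x).right_inv hy, chartMetric_apply, coordVector_chartVector x hy,
    coordVector_chartVector x hy]

lemma chartMetric_symm (g : LorentzianMetric m M) (x : M) (y v w : Em) :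
    chartMetric g x y v w = chartMetric g x y w v := g.symm _ _ _

lemma LorentzianMetric.nondegenerate (g : LorentzianMetric m M) (x : M) (v : TangentSpace (𝓡 m) x)
    (h : ∀ w, g.val x v w = 0) : v = 0 := by
  obtain ⟨b, hb⟩ := g.signature x
  apply b.repr.map_eq_zero_iff.1
  ext i
  have h1 := h (b i)
  rw [← b.sum_repr v] at h1
  simp only [map_sum, map_smul, sum_apply, smul_apply,
    hb, smul_eq_mul, mul_ite, mul_zero, Finset.sum_ite_eq', Finset.mem_univ, if_true] at h1
  split_ifs at h1 <;> simpa using h1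

/-- The components of a vector field, in the trivialization of the tangent bundle at `x`. -/
lemma trivializationAt_eq_chartVector {x z : M} (hz : z ∈ (extChartAt (𝓡 m) x).source)
    (v : TangentSpace (𝓡 m) z) :
    (trivializationAt Em (TangentSpace (𝓡 m)) x ⟨z, v⟩).2 = chartVector x v := by
  have := isManifold_one (m := m) (M := M)
  have hz' : z ∈ (chartAt Em x).source := by simpa using hz
  rw [← chartVectorL_apply, chartVectorL,
    ← TangentBundle.continuousLinearMapAt_trivializationAt hz']
  exact (Trivialization.continuousLinearMapAt_apply_of_mem ℝ _ (by simpa using hz') v).symm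

/-- Smoothness of a vector field in terms of its components in a chart. -/
lemma contMDiffAt_of_contDiffAt_chartVector (V : ∀ x : M, TangentSpace (𝓡 m) x) (x : M)
    (h : ContDiffAt ℝ ∞ (fun y ↦ chartVector x (V ((extChartAt (𝓡 m) x).symm y)))
      (extChartAt (𝓡 m) x x)) :
    ContMDiffAt (𝓡 m) (𝓡 m).tangent ∞ (fun x ↦ (⟨x, V x⟩ : TangentBundle (𝓡 m) M)) x := by
  have h1 : ContMDiffAt (𝓡 m) 𝓘(ℝ, Em) ∞
      ((fun y ↦ chartVector x (V ((extChartAt (𝓡 m) x).symm y))) ∘ extChartAt (𝓡 m) x) x :=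
    h.contMDiffAt.comp x contMDiffAt_extChartAt
  refine (contMDiffAt_section (E := TangentSpace (𝓡 m)) (F := Em) x).2
    (h1.congr_of_eventuallyEq ?_)
  filter_upwards [extChartAt_source_mem_nhds (I := 𝓡 m) x] with z hz
  rw [trivializationAt_eq_chartVector hz]
  simp only [Function.comp_apply]
  rw [(extChartAt (𝓡 m) x).left_inv hz]

lemma contDiffAt_chartVector (V : ∀ x : M, TangentSpace (𝓡 m) x) (x : M)
    (h : ContMDiffAt (𝓡 m) (𝓡 m).tangent ∞ (fun x ↦ (⟨x, V x⟩ : TangentBundle (𝓡 m) M)) x) :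
    ContDiffAt ℝ ∞ (fun y ↦ chartVector x (V ((extChartAt (𝓡 m) x).symm y)))
      (extChartAt (𝓡 m) x x) := by
  have h1 := (contMDiffAt_section (E := TangentSpace (𝓡 m)) (F := Em) x).1 h
  have h2 : ContMDiffAt 𝓘(ℝ, Em) (𝓡 m) ∞ (extChartAt (𝓡 m) x).symm (extChartAt (𝓡 m) x x) :=
    (contMDiffOn_extChartAt_symm x).contMDiffAt
      ((isOpen_chartTarget x).mem_nhds (mem_extChartAt_target x))
  have h3 := ContMDiffAt.comp_of_eq (x := extChartAt (𝓡 m) x x) h1 h2 (extChartAt_to_inv x)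
  refine h3.contDiffAt.congr_of_eventuallyEq ?_
  filter_upwards [(isOpen_chartTarget x).mem_nhds (mem_extChartAt_target x)] with y hy
  simp only [Function.comp_apply]
  rw [trivializationAt_eq_chartVector ((extChartAt (𝓡 m) x).map_target hy)]

/-- The components of a continuous vector field along a map are continuous. -/
lemma continuousWithinAt_chartVector {Y : Type*} [TopologicalSpace Y] {x : M} {f : Y → M}
    {V : ∀ t : Y, TangentSpace (𝓡 m) (f t)} {s : Set Y} {t : Y}
    (hx : f t ∈ (extChartAt (𝓡 m) x).source)
    (h : ContinuousWithinAt (fun t ↦ (⟨f t, V t⟩ : TangentBundle (𝓡 m) M)) s t) :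
    ContinuousWithinAt (fun t ↦ chartVector x (V t)) s t := by
  have hf : ContinuousWithinAt f s t :=
    (FiberBundle.continuous_proj Em (TangentSpace (𝓡 m) (M := M))).continuousAt.comp_continuousWithinAt
      (f := fun t ↦ (⟨f t, V t⟩ : TangentBundle (𝓡 m) M)) h
  let e := trivializationAt Em (TangentSpace (𝓡 m)) x
  have he : ContinuousAt e (⟨f t, V t⟩ : TangentBundle (𝓡 m) M) :=
    e.continuousAt (by simpa [e, Trivialization.mem_source] using hx)
  have h1 := (continuous_snd.continuousAt.comp he).comp_continuousWithinAt
    (f := fun t ↦ (⟨f t, V t⟩ : TangentBundle (𝓡 m) M)) h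
  refine h1.congr_of_eventuallyEq ?_ (trivializationAt_eq_chartVector hx _).symm
  filter_upwards [hf.preimage_mem_nhdsWithin ((isOpen_extChartAt_source x).mem_nhds hx)] with z hz
  exact (trivializationAt_eq_chartVector hz _).symm

end Charts

/-! ### Symmetric bilinear forms depending on a point of a vector space -/

section BilinearForms

variable {F : Type*} [NormedAddCommGroup F] [NormedSpace ℝ F]

/-- The bilinear map sending `(v, w)` to the value of `A` at the functional
`z ↦ (D v w z + D w v z - D z v w) / 2`. With `D` the derivative of a metric and `A` the inverse of
the metric, these are the Christoffel symbols, as a continuous bilinear map. -/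
def koszulMap (A : (F →L[ℝ] ℝ) →L[ℝ] F) (D : F →L[ℝ] F →L[ℝ] F →L[ℝ] ℝ) : F →L[ℝ] F →L[ℝ] F :=
  (ContinuousLinearMap.compL ℝ F (F →L[ℝ] ℝ) F A).comp
    ((1 / 2 : ℝ) • (D + D.flip
      - (ContinuousLinearMap.flipₗᵢ ℝ F F ℝ).toContinuousLinearEquiv.toContinuousLinearMap.comp
        D.flip))

lemma contDiffOn_koszulMap [FiniteDimensional ℝ F] {G : F → F →L[ℝ] F →L[ℝ] ℝ} {s : Set F}
    (hs : IsOpen s) (hG : ContDiffOn ℝ ∞ G s) (hi : ∀ y ∈ s, (G y).IsInvertible) :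
    ContDiffOn ℝ ∞ (fun y ↦ koszulMap (G y).inverse (fderiv ℝ G y)) s := by
  have := FiniteDimensional.complete ℝ F
  have hD : ContDiffOn ℝ ∞ (fderiv ℝ G) s := hG.fderiv_of_isOpen hs (by simp)
  have hI : ContDiffOn ℝ ∞ (fun y ↦ (G y).inverse) s :=
    fun y hy ↦ ((hi y hy).contDiffAt_map_inverse).comp_contDiffWithinAt y (hG y hy)
  have happ : ∀ a b c : F, ContDiffOn ℝ ∞ (fun y ↦ fderiv ℝ G y a b c) s := fun a b c ↦
    ((hD.clm_apply contDiffOn_const).clm_apply contDiffOn_const).clm_apply contDiffOn_const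
  refine contDiffOn_clm_apply.2 fun v ↦ contDiffOn_clm_apply.2 fun w ↦ ?_
  refine hI.clm_apply (contDiffOn_clm_apply.2 fun z ↦ ?_)
  exact ((happ v w z).add (happ w v z) |>.sub (happ z v w)).const_smul (1 / 2 : ℝ)

lemma fderiv_symm_of_symm {G : F → F →L[ℝ] F →L[ℝ] ℝ} {y : F} (hG : DifferentiableAt ℝ G y)
    (hsymm : ∀ y v w, G y v w = G y w v) (v w z : F) :
    fderiv ℝ G y v w z = fderiv ℝ G y v z w := by
  have h1 : ∀ w z : F, HasFDerivAt (fun y ↦ G y w z) (((fderiv ℝ G y).flip w).flip z) y :=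
    fun w z ↦ by
      convert! (hG.hasFDerivAt.clm_apply (hasFDerivAt_const w y)).clm_apply
        (hasFDerivAt_const z y) using 1
      ext; simp
  have h2 : (fun y ↦ G y w z) = fun y ↦ G y z w := funext fun y ↦ hsymm y w z
  have h3 := (h1 w z).unique (h2 ▸ h1 z w)
  exact congrArg (fun f : F →L[ℝ] ℝ ↦ f v) h3

/-- The derivative of the pullback `G` of a family `G'` of bilinear forms under a map `φ`. -/
lemma fderiv_pullback {G G' : F → F →L[ℝ] F →L[ℝ] ℝ} {φ : F → F} {φ' : F → F →L[ℝ] F}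
    {φ'' : F →L[ℝ] F →L[ℝ] F} {y : F} (hG : DifferentiableAt ℝ G y)
    (hG' : DifferentiableAt ℝ G' (φ y)) (hφ : HasFDerivAt φ (φ' y) y) (hφ' : HasFDerivAt φ' φ'' y)
    (h : ∀ᶠ y in 𝓝 y, ∀ w z, G y w z = G' (φ y) (φ' y w) (φ' y z)) (v w z : F) :
    fderiv ℝ G y v w z = fderiv ℝ G' (φ y) (φ' y v) (φ' y w) (φ' y z)
      + G' (φ y) (φ'' v w) (φ' y z) + G' (φ y) (φ' y w) (φ'' v z) := by
  have h1 := ((hG'.hasFDerivAt.comp y hφ).clm_apply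
    (hφ'.clm_apply (hasFDerivAt_const w y))).clm_apply (hφ'.clm_apply (hasFDerivAt_const z y))
  have h2 := (hG.hasFDerivAt.clm_apply (hasFDerivAt_const w y)).clm_apply (hasFDerivAt_const z y)
  have h3 : HasFDerivAt (fun y ↦ G y w z) _ y := h1.congr_of_eventuallyEq (h.mono fun y hy ↦ hy w z)
  have h4 := congrArg (fun f : F →L[ℝ] ℝ ↦ f v) (h2.unique h3)
  simp at h4
  rw [h4]
  ring

end BilinearForms

/-! ### The metric and the Christoffel symbols in charts -/

section Christoffel

variable {m : ℕ} {M : Type*} [TopologicalSpace M]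
  [ChartedSpace (EuclideanSpace ℝ (Fin m)) M] [IsManifold (𝓡 m) ∞ M]

local notation "Em" => EuclideanSpace ℝ (Fin m)

lemma contDiffOn_chartMetric (g : LorentzianMetric m M) (x : M) :
    ContDiffOn ℝ ∞ (chartMetric g x) (extChartAt (𝓡 m) x).target := by
  refine contDiffOn_clm_apply.2 fun v ↦ contDiffOn_clm_apply.2 fun w ↦ ?_
  let e := trivializationAt Em (TangentSpace (𝓡 m) (M := M)) x
  have hbase : e.baseSet = (extChartAt (𝓡 m) x).source := by simp [e]
  have key : ∀ u : Em, ContMDiffOn (𝓡 m) ((𝓡 m).prod 𝓘(ℝ, Em)) ∞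
      (fun z ↦ TotalSpace.mk' Em (E := TangentSpace (𝓡 m)) z (e.symm z u)) e.baseSet := by
    intro u
    rw [e.contMDiffOn_section_baseSet_iff]
    refine (contMDiffOn_const (c := u)).congr fun z hz ↦ ?_
    rw [Trivialization.apply_mk_symm e hz]
  have h1 : ContMDiffOn (𝓡 m) 𝓘(ℝ, ℝ) ∞ (fun z ↦ g.val z (e.symm z v) (e.symm z w)) e.baseSet := by
    intro z hz
    have h2 : ContMDiffWithinAt (𝓡 m) ((𝓡 m).prod 𝓘(ℝ)) ∞
        (fun z ↦ TotalSpace.mk' ℝ (E := Bundle.Trivial M ℝ) z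
          (g.val z (e.symm z v) (e.symm z w))) e.baseSet z := by
      apply ContMDiffWithinAt.clm_bundle_apply₂ (F₁ := Em) (F₂ := Em)
      · exact g.contMDiff.contMDiffAt.contMDiffWithinAt
      · exact key v z hz
      · exact key w z hz
    simp only [contMDiffWithinAt_totalSpace] at h2
    exact h2.2
  have h3 := h1.comp (contMDiffOn_extChartAt_symm (n := ∞) (I := 𝓡 m) x)
    (fun y hy ↦ by simpa only [hbase, mem_preimage] using (extChartAt (𝓡 m) x).map_target hy)
  refine h3.contDiffOn.congr fun y hy ↦ ?_
  have hz := (extChartAt (𝓡 m) x).map_target hy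
  have h4 : ∀ u : Em, e.symm ((extChartAt (𝓡 m) x).symm y) u = coordVector x y u := by
    intro u
    apply (chartVectorEquiv x hz).injective
    rw [chartVectorEquiv_apply, chartVectorEquiv_apply, chartVector_coordVector x hy,
      ← trivializationAt_eq_chartVector hz, Trivialization.apply_mk_symm e (hbase ▸ hz)]
  simp only [Function.comp_apply, h4, chartMetric_apply]

lemma chartMetric_nondegenerate (g : LorentzianMetric m M) (x : M) {y : Em}
    (hy : y ∈ (extChartAt (𝓡 m) x).target) {v : Em} (h : ∀ w, chartMetric g x y v w = 0) :
    v = 0 := by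
  have h1 : coordVector x y v = 0 := by
    refine g.nondegenerate _ _ fun w ↦ ?_
    rw [← coordVector_chartVector x hy w]
    exact h _
  rw [← chartVector_coordVector x hy v, h1]
  exact map_zero (chartVectorL x _)

lemma isInvertible_chartMetric (g : LorentzianMetric m M) (x : M) {y : Em}
    (hy : y ∈ (extChartAt (𝓡 m) x).target) : (chartMetric g x y).IsInvertible := by
  have hinj : Function.Injective (chartMetric g x y) := by
    refine (injective_iff_map_eq_zero _).2 fun v hv ↦ chartMetric_nondegenerate g x hy fun w ↦ ?_
    rw [hv]; rfl
  have hrank : Module.finrank ℝ Em = Module.finrank ℝ (Em →L[ℝ] ℝ) := by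
    rw [← (LinearMap.toContinuousLinearMap (𝕜 := ℝ) (E := Em) (F' := ℝ)).finrank_eq]
    exact (Subspace.dual_finrank_eq).symm
  exact ⟨(LinearEquiv.ofInjectiveOfFinrankEq (chartMetric g x y).toLinearMap hinj
    hrank).toContinuousLinearEquiv, by ext; rfl⟩

lemma differentiableAt_chartMetric (g : LorentzianMetric m M) (x : M) {y : Em}
    (hy : y ∈ (extChartAt (𝓡 m) x).target) : DifferentiableAt ℝ (chartMetric g x) y :=
  ((contDiffOn_chartMetric g x).contDiffAt ((isOpen_chartTarget x).mem_nhds hy)).differentiableAt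
    (by simp)

/-- The Koszul formula in a chart. -/
lemma chartMetric_christoffel (g : LorentzianMetric m M) (x : M) {y : Em}
    (hy : y ∈ (extChartAt (𝓡 m) x).target) (v w z : Em) :
    2 * chartMetric g x y (christoffel g x y v w) z =
      fderiv ℝ (chartMetric g x) y v w z + fderiv ℝ (chartMetric g x) y w v z
        - fderiv ℝ (chartMetric g x) y z v w := by
  have h := (isInvertible_chartMetric g x hy).inverse_apply_eq (y := ((1 / 2 : ℝ) •
    (fderiv ℝ (chartMetric g x) y v w + fderiv ℝ (chartMetric g x) y w v
      - ((fderiv ℝ (chartMetric g x) y).flip v).flip w))) (x := christoffel g x y v w)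
  rw [← h.1 rfl]
  simp

lemma fderiv_chartMetric_symm (g : LorentzianMetric m M) (x : M) {y : Em}
    (hy : y ∈ (extChartAt (𝓡 m) x).target) (v w z : Em) :
    fderiv ℝ (chartMetric g x) y v w z = fderiv ℝ (chartMetric g x) y v z w :=
  fderiv_symm_of_symm (differentiableAt_chartMetric g x hy) (chartMetric_symm g x) v w z

/-- The Levi-Civita connection is compatible with the metric. -/
lemma fderiv_chartMetric (g : LorentzianMetric m M) (x : M) {y : Em}
    (hy : y ∈ (extChartAt (𝓡 m) x).target) (v w z : Em) :
    fderiv ℝ (chartMetric g x) y v w z =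
      chartMetric g x y (christoffel g x y v w) z + chartMetric g x y w (christoffel g x y v z) := by
  have h1 := chartMetric_christoffel g x hy v w z
  have h2 := chartMetric_christoffel g x hy v z w
  have h3 := fderiv_chartMetric_symm g x hy v w z
  have h4 := fderiv_chartMetric_symm g x hy w v z
  have h5 := fderiv_chartMetric_symm g x hy z v w
  rw [chartMetric_symm g x y w]
  linarith

/-- The Christoffel symbols as a continuous bilinear map. -/
def christoffelL (g : LorentzianMetric m M) (x : M) (y : Em) : Em →L[ℝ] Em →L[ℝ] Em :=
  koszulMap (chartMetric g x y).inverse (fderiv ℝ (chartMetric g x) y)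

lemma christoffelL_apply (g : LorentzianMetric m M) (x : M) (y v w : Em) :
    christoffelL g x y v w = christoffel g x y v w := rfl

lemma contDiffOn_christoffelL (g : LorentzianMetric m M) (x : M) :
    ContDiffOn ℝ ∞ (christoffelL g x) (extChartAt (𝓡 m) x).target :=
  contDiffOn_koszulMap (isOpen_chartTarget x) (contDiffOn_chartMetric g x)
    fun _ ↦ isInvertible_chartMetric g x

end Christoffel

/-! ### Change of charts -/

section CoordChange

variable {m : ℕ} {M : Type*} [TopologicalSpace M]
  [ChartedSpace (EuclideanSpace ℝ (Fin m)) M] [IsManifold (𝓡 m) ∞ M]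

local notation "Em" => EuclideanSpace ℝ (Fin m)

/-- The transition map from the chart around `x` to the chart around `x'`. -/
def chartChange (x x' : M) : Em → Em := extChartAt (𝓡 m) x' ∘ (extChartAt (𝓡 m) x).symm

/-- The domain of the transition map from the chart around `x` to the chart around `x'`. -/
def chartOverlap (x x' : M) : Set Em :=
  (extChartAt (𝓡 m) x).target ∩ (extChartAt (𝓡 m) x).symm ⁻¹' (extChartAt (𝓡 m) x').source

lemma isOpen_chartOverlap (x x' : M) : IsOpen (chartOverlap (m := m) x x') :=
  (continuousOn_extChartAt_symm x).isOpen_inter_preimage (isOpen_chartTarget x)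
    (isOpen_extChartAt_source x')

lemma contDiffOn_chartChange (x x' : M) :
    ContDiffOn ℝ ∞ (chartChange (m := m) x x') (chartOverlap x x') :=
  contMDiffOn_iff_contDiffOn.1 <|
    (contMDiffOn_extChartAt (I := 𝓡 m) (n := ∞) (x := x')).comp
      ((contMDiffOn_extChartAt_symm (I := 𝓡 m) (n := ∞) x).mono inter_subset_left)
      (fun y hy ↦ by simpa using hy.2)

lemma chartVector_eq_fderiv_chartChange {x x' : M} {y : Em} (hy : y ∈ chartOverlap x x')
    (v : TangentSpace (𝓡 m) ((extChartAt (𝓡 m) x).symm y)) :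
    chartVector x' v = fderiv ℝ (chartChange x x') y (chartVector x v) := by
  have := isManifold_one (m := m) (M := M)
  have h1 : MDifferentiableAt 𝓘(ℝ, Em) (𝓡 m) (extChartAt (𝓡 m) x).symm y :=
    ((contMDiffOn_extChartAt_symm (I := 𝓡 m) (n := ∞) x).contMDiffAt
      ((isOpen_chartTarget x).mem_nhds hy.1)).mdifferentiableAt (by simp)
  have h2 : MDifferentiableAt (𝓡 m) 𝓘(ℝ, Em) (extChartAt (𝓡 m) x') ((extChartAt (𝓡 m) x).symm y) :=
    mdifferentiableAt_extChartAt (by simpa using hy.2)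
  have h3 := mfderiv_comp y h2 h1
  rw [← mfderiv_eq_fderiv]
  have h4 := congrArg (fun f : Em →L[ℝ] Em ↦ f (chartVector x v)) h3
  refine Eq.trans ?_ h4.symm
  change _ = chartVector x' (coordVector x y (chartVector x v))
  rw [coordVector_chartVector x hy.1]

lemma chartMetric_chartChange (g : LorentzianMetric m M) {x x' : M} {y : Em}
    (hy : y ∈ chartOverlap x x') (v w : Em) :
    chartMetric g x' (chartChange x x' y) (fderiv ℝ (chartChange x x') y v)
      (fderiv ℝ (chartChange x x') y w) = chartMetric g x y v w := by
  have h := chartMetric_chartVector g hy.2 (coordVector x y v) (coordVector x y w)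
  rwa [chartVector_eq_fderiv_chartChange hy, chartVector_eq_fderiv_chartChange hy,
    chartVector_coordVector x hy.1, chartVector_coordVector x hy.1] at h

lemma surjective_fderiv_chartChange {x x' : M} {y : Em} (hy : y ∈ chartOverlap x x') :
    Function.Surjective (fderiv ℝ (chartChange x x') y) := by
  intro w
  obtain ⟨v, hv⟩ := (chartVectorEquiv x' hy.2).surjective w
  exact ⟨chartVector x v, by rw [← chartVector_eq_fderiv_chartChange hy]; exact hv⟩

lemma hasFDerivAt_chartChange {x x' : M} {y : Em} (hy : y ∈ chartOverlap x x') :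
    HasFDerivAt (chartChange x x') (fderiv ℝ (chartChange x x') y) y :=
  (((contDiffOn_chartChange x x').contDiffAt
    ((isOpen_chartOverlap x x').mem_nhds hy)).differentiableAt (by simp)).hasFDerivAt

lemma hasFDerivAt_fderiv_chartChange {x x' : M} {y : Em} (hy : y ∈ chartOverlap x x') :
    HasFDerivAt (fderiv ℝ (chartChange x x')) (fderiv ℝ (fderiv ℝ (chartChange x x')) y) y :=
  ((((contDiffOn_chartChange x x').fderiv_of_isOpen (m := ∞) (isOpen_chartOverlap x x')
    (by simp)).contDiffAt
    ((isOpen_chartOverlap x x').mem_nhds hy)).differentiableAt (by simp)).hasFDerivAt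

lemma fderiv_fderiv_chartChange_symm {x x' : M} {y : Em} (hy : y ∈ chartOverlap x x') (v w : Em) :
    fderiv ℝ (fderiv ℝ (chartChange x x')) y v w = fderiv ℝ (fderiv ℝ (chartChange x x')) y w v := by
  refine second_derivative_symmetric_of_eventually_of_real (f := chartChange x x') ?_
    (hasFDerivAt_fderiv_chartChange hy) v w
  filter_upwards [(isOpen_chartOverlap x x').mem_nhds hy] with z hz using hasFDerivAt_chartChange hz

lemma chartChange_mem_target {x x' : M} {y : Em} (hy : y ∈ chartOverlap x x') :
    chartChange x x' y ∈ (extChartAt (𝓡 m) x').target :=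
  (extChartAt (𝓡 m) x').map_source hy.2

lemma fderiv_chartMetric_chartChange (g : LorentzianMetric m M) {x x' : M} {y : Em}
    (hy : y ∈ chartOverlap x x') (v w z : Em) :
    fderiv ℝ (chartMetric g x) y v w z =
      fderiv ℝ (chartMetric g x') (chartChange x x' y) (fderiv ℝ (chartChange x x') y v)
        (fderiv ℝ (chartChange x x') y w) (fderiv ℝ (chartChange x x') y z)
      + chartMetric g x' (chartChange x x' y) (fderiv ℝ (fderiv ℝ (chartChange x x')) y v w)
        (fderiv ℝ (chartChange x x') y z)
      + chartMetric g x' (chartChange x x' y) (fderiv ℝ (chartChange x x') y w)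
        (fderiv ℝ (fderiv ℝ (chartChange x x')) y v z) := by
  refine fderiv_pullback (differentiableAt_chartMetric g x hy.1)
    (differentiableAt_chartMetric g x' (chartChange_mem_target hy)) (hasFDerivAt_chartChange hy)
    (hasFDerivAt_fderiv_chartChange hy) ?_ v w z
  filter_upwards [(isOpen_chartOverlap x x').mem_nhds hy] with z hz w w'
  exact (chartMetric_chartChange g hz _ _).symm

/-- The transformation law of the Christoffel symbols: with `φ` a transition map,
`Γ'(φ' v, φ' w) + φ''(v, w) = φ' Γ(v, w)`. -/
lemma christoffel_chartChange (g : LorentzianMetric m M) {x x' : M} {y : Em}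
    (hy : y ∈ chartOverlap x x') (v w : Em) :
    christoffel g x' (chartChange x x' y) (fderiv ℝ (chartChange x x') y v)
        (fderiv ℝ (chartChange x x') y w) + fderiv ℝ (fderiv ℝ (chartChange x x')) y v w =
      fderiv ℝ (chartChange x x') y (christoffel g x y v w) := by
  refine sub_eq_zero.1 (chartMetric_nondegenerate g x' (chartChange_mem_target hy) fun z' ↦ ?_)
  obtain ⟨z, rfl⟩ := surjective_fderiv_chartChange hy z'
  rw [map_sub, sub_apply, map_add, add_apply, chartMetric_chartChange g hy]
  have h1 := chartMetric_christoffel g x hy.1 v w z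
  have h2 := chartMetric_christoffel g x' (chartChange_mem_target hy)
    (fderiv ℝ (chartChange x x') y v) (fderiv ℝ (chartChange x x') y w)
    (fderiv ℝ (chartChange x x') y z)
  rw [fderiv_chartMetric_chartChange g hy, fderiv_chartMetric_chartChange g hy,
    fderiv_chartMetric_chartChange g hy] at h1
  rw [fderiv_fderiv_chartChange_symm hy w v, fderiv_fderiv_chartChange_symm hy z v,
    fderiv_fderiv_chartChange_symm hy z w] at h1
  rw [chartMetric_symm g x' _ (fderiv ℝ (chartChange x x') y w)
    (fderiv ℝ (fderiv ℝ (chartChange x x')) y v z)] at h1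
  linarith

end CoordChange

/-! ### Lorentzian linear algebra -/

section LinearAlgebra

variable {V : Type*} [AddCommGroup V] [Module ℝ V]

/-- A symmetric bilinear form with an orthonormal basis whose first vector has square `-1`, all
others having square `1`. -/
def IsLorentzForm (B : LinearMap.BilinForm ℝ V) : Prop :=
  (∀ v w, B v w = B w v) ∧ ∃ n : ℕ, ∃ b : Module.Basis (Fin n) ℝ V,
    ∀ i j, B (b i) (b j) = if i = j then (if (i : ℕ) = 0 then -1 else 1) else 0

/-- The orthogonal complement of a timelike vector is spacelike. -/
lemma IsLorentzForm.pos_of_orthogonal {B : LinearMap.BilinForm ℝ V} (hB : IsLorentzForm B)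
    {t v : V} (ht : B t t < 0) (htv : B t v = 0) (hv : v ≠ 0) : 0 < B v v := by
  obtain ⟨-, n, b, hb⟩ := hB
  have hexp : ∀ x y : V, B x y =
      ∑ i, b.repr x i * b.repr y i * (if (i : ℕ) = 0 then -1 else 1) := by
    intro x y
    conv_lhs => rw [← b.sum_repr x, ← b.sum_repr y]
    simp only [map_sum, map_smul, LinearMap.sum_apply, LinearMap.smul_apply, hb, smul_eq_mul,
      mul_ite, mul_zero, Finset.sum_ite_eq', Finset.mem_univ, if_true]
    refine Finset.sum_congr rfl fun i _ ↦ ?_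
    split_ifs <;> ring
  rcases n with _ | n
  · simp [hexp] at ht
  rw [hexp, Fin.sum_univ_succ] at ht htv ⊢
  simp only [Fin.val_zero, if_true, Fin.val_succ, Nat.add_eq_zero_iff, one_ne_zero, and_false,
    if_false, mul_one] at ht htv ⊢
  -- the Cauchy-Schwarz inequality for the spatial parts of `t` and `v`
  have hcs := Finset.sum_mul_sq_le_sq_mul_sq Finset.univ (fun i : Fin n ↦ b.repr t i.succ)
    (fun i : Fin n ↦ b.repr v i.succ)
  simp only [pow_two] at hcs
  have ha : 0 ≤ ∑ i : Fin n, b.repr t i.succ * b.repr t i.succ :=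
    Finset.sum_nonneg fun i _ ↦ mul_self_nonneg _
  have hc : 0 ≤ ∑ i : Fin n, b.repr v i.succ * b.repr v i.succ :=
    Finset.sum_nonneg fun i _ ↦ mul_self_nonneg _
  set a := ∑ i : Fin n, b.repr t i.succ * b.repr t i.succ
  set c := ∑ i : Fin n, b.repr v i.succ * b.repr v i.succ with hc_def
  set d := ∑ i : Fin n, b.repr t i.succ * b.repr v i.succ
  have ht0 : 0 < b.repr t 0 * b.repr t 0 := by linarith
  have ht0' : b.repr t 0 ≠ 0 := fun h ↦ by simp [h] at ht0
  have hd : d = b.repr t 0 * b.repr v 0 := by linarith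
  rw [hd] at hcs
  rcases hc.eq_or_lt with h0 | hpos
  · -- the spatial part of `v` vanishes, hence so does its time component
    exfalso
    rw [← h0, mul_zero] at hcs
    have hv0 : b.repr v 0 = 0 := by
      have : b.repr t 0 * b.repr v 0 = 0 := mul_self_eq_zero.1 (le_antisymm hcs (mul_self_nonneg _))
      exact (mul_eq_zero.1 this).resolve_left ht0'
    refine hv (b.repr.map_eq_zero_iff.1 ?_)
    ext i
    refine Fin.cases hv0 (fun i ↦ ?_) i
    have := (Finset.sum_eq_zero_iff_of_nonneg
      (fun i _ ↦ mul_self_nonneg (b.repr v (Fin.succ i)))).1 (hc_def.symm.trans h0.symm) i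
      (Finset.mem_univ _)
    simpa using this
  · have h1 : a * c < b.repr t 0 * b.repr t 0 * c := mul_lt_mul_of_pos_right (by linarith) hpos
    have h2 : b.repr t 0 * b.repr t 0 * (b.repr v 0 * b.repr v 0) < b.repr t 0 * b.repr t 0 * c := by
      nlinarith
    have h3 := lt_of_mul_lt_mul_left h2 ht0.le
    linarith

lemma IsLorentzForm.nonneg_of_orthogonal {B : LinearMap.BilinForm ℝ V} (hB : IsLorentzForm B)
    {t v : V} (ht : B t t < 0) (htv : B t v = 0) : 0 ≤ B v v := by
  rcases eq_or_ne v 0 with rfl | hv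
  · simp
  · exact (hB.pos_of_orthogonal ht htv hv).le

/-- Timelike vectors are never orthogonal. -/
lemma IsLorentzForm.ne_zero_of_timelike {B : LinearMap.BilinForm ℝ V} (hB : IsLorentzForm B)
    {u v : V} (hu : B u u < 0) (hv : B v v < 0) : B u v ≠ 0 :=
  fun h ↦ hv.not_ge (hB.nonneg_of_orthogonal hu h)

/-- The reversed Cauchy-Schwarz inequality. -/
lemma IsLorentzForm.mul_le_sq {B : LinearMap.BilinForm ℝ V} (hB : IsLorentzForm B)
    {u : V} (hu : B u u < 0) (v : V) : B u u * B v v ≤ B u v ^ 2 := by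
  have h := hB.nonneg_of_orthogonal (v := B u u • v - B u v • u) hu (by simp; ring)
  simp only [map_sub, map_smul, LinearMap.sub_apply, LinearMap.smul_apply, smul_eq_mul,
    hB.1 v u] at h
  have h1 : 0 ≤ B u u * (B u u * B v v - B u v ^ 2) := by linarith
  nlinarith

/-- Two vectors in the timecone of `t` belong to the timecone of each other. -/
lemma IsLorentzForm.neg_of_neg {B : LinearMap.BilinForm ℝ V} (hB : IsLorentzForm B)
    {t u v : V} (ht : B t t < 0) (hu : B u u < 0) (hv : B v v < 0) (hut : B u t < 0)
    (hvt : B v t < 0) : B u v < 0 := by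
  have h := hB.nonneg_of_orthogonal (v := B v t • u - B u t • v) ht
    (by simp [hB.1 t]; ring)
  simp only [map_sub, map_smul, LinearMap.sub_apply, LinearMap.smul_apply, smul_eq_mul,
    hB.1 v u] at h
  have h1 : 0 < B u t * B v t := mul_pos_of_neg_of_neg hut hvt
  have h2 : 0 < B v t ^ 2 := sq_pos_of_neg hvt
  have h3 : 0 < B u t ^ 2 := sq_pos_of_neg hut
  nlinarith

/-- Orthonormal families in a subspace on which the form is positive definite. -/
lemma exists_orthonormal_of_posDef [FiniteDimensional ℝ V] {B : LinearMap.BilinForm ℝ V}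
    (hsymm : ∀ v w, B v w = B w v) (W : Submodule ℝ V) (hW : ∀ w ∈ W, w ≠ 0 → 0 < B w w) {n : ℕ}
    (hn : n ≤ Module.finrank ℝ W) :
    ∃ e : Fin n → V, (∀ i, e i ∈ W) ∧ ∀ i j, B (e i) (e j) = if i = j then 1 else 0 := by
  obtain ⟨v, hv⟩ := LinearMap.BilinForm.exists_orthogonal_basis (B := B.restrict W)
    ⟨fun x y ↦ hsymm x y⟩
  have hpos : ∀ i, 0 < B (v i) (v i) := fun i ↦ hW _ (v i).2 (by simpa using v.ne_zero i)
  refine ⟨fun i ↦ (√(B (v (Fin.castLE hn i)) (v (Fin.castLE hn i))))⁻¹ • (v (Fin.castLE hn i) : V),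
    fun i ↦ W.smul_mem _ (v _).2, fun i j ↦ ?_⟩
  simp only [map_smul, LinearMap.smul_apply, smul_eq_mul]
  split_ifs with h
  · subst h
    have := Real.mul_self_sqrt (hpos (Fin.castLE hn i)).le
    have h0 := (Real.sqrt_pos.2 (hpos (Fin.castLE hn i))).ne'
    field_simp
    linarith
  · have h1 : B (v (Fin.castLE hn i)) (v (Fin.castLE hn j)) = 0 :=
      hv (fun h' ↦ h (Fin.castLE_injective hn h'))
    simp [h1]

lemma linearIndependent_of_orthogonal {ι : Type*} {B : LinearMap.BilinForm ℝ V}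
    {e : ι → V} (h : ∀ i j, i ≠ j → B (e i) (e j) = 0) (h0 : ∀ i, B (e i) (e i) ≠ 0) :
    LinearIndependent ℝ e :=
  LinearMap.BilinForm.linearIndependent_of_iIsOrtho (B := B) (fun i j hij ↦ h i j hij) h0

lemma repr_mul_eq {ι : Type*} [Fintype ι] {B : LinearMap.BilinForm ℝ V} (b : Module.Basis ι ℝ V)
    (h : ∀ i j, i ≠ j → B (b i) (b j) = 0) (v : V) (i : ι) :
    B (b i) v = b.repr v i * B (b i) (b i) := by
  conv_lhs => rw [← b.sum_repr v]
  simp only [map_sum, map_smul, smul_eq_mul]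
  refine Finset.sum_eq_single i (fun j _ hj ↦ ?_) (fun h ↦ (h (Finset.mem_univ _)).elim)
  rw [h i j hj.symm, mul_zero]

/-- The matrix of an orientation-preserving isometry fixing the first `k` vectors of an orthonormal
basis whose other vectors are spacelike. -/
lemma exists_specialOrthogonal_of_isometry {k n : ℕ} {B : LinearMap.BilinForm ℝ V}
    (b : Module.Basis (Fin k ⊕ Fin n) ℝ V)
    (h : ∀ i j, i ≠ j → B (b i) (b j) = 0) (h0 : ∀ i, B (b i) (b i) ≠ 0)
    (h1 : ∀ j, B (b (Sum.inr j)) (b (Sum.inr j)) = 1) {P : V →ₗ[ℝ] V}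
    (hP : ∀ v w, B (P v) (P w) = B v w) (hfix : ∀ i, P (b (Sum.inl i)) = b (Sum.inl i))
    (hdet : 0 < LinearMap.det P) :
    ∃ A ∈ Matrix.specialOrthogonalGroup (Fin n) ℝ,
      LinearMap.toMatrix b b P = Matrix.fromBlocks 1 0 0 A := by
  set M := LinearMap.toMatrix b b P with hM
  have hMij : ∀ i j, M i j = b.repr (P (b j)) i := fun i j ↦ LinearMap.toMatrix_apply b b P i j
  have hblock : M = Matrix.fromBlocks 1 0 0 M.toBlocks₂₂ := by
    conv_lhs => rw [← Matrix.fromBlocks_toBlocks M]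
    congr 1
    · ext i j
      simp [Matrix.toBlocks₁₁, hMij, hfix, Matrix.one_apply, Finsupp.single_apply, eq_comm]
    · ext i j
      have h2 := repr_mul_eq b h (P (b (Sum.inr j))) (Sum.inl i)
      rw [← hfix, hP, hfix, h _ _ (by simp)] at h2
      simpa [Matrix.toBlocks₁₂, hMij, h0] using h2.symm
    · ext i j
      simp [Matrix.toBlocks₂₁, hMij, hfix]
  refine ⟨M.toBlocks₂₂, ?_, hblock⟩
  have hPb : ∀ j, P (b (Sum.inr j)) = ∑ l, M.toBlocks₂₂ l j • b (Sum.inr l) := by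
    intro j
    conv_lhs => rw [← b.sum_repr (P (b (Sum.inr j)))]
    simp_rw [← hMij]
    rw [hblock, Fintype.sum_sum_type]
    simp
  have horth : M.toBlocks₂₂ ∈ Matrix.orthogonalGroup (Fin n) ℝ := by
    rw [Matrix.mem_orthogonalGroup_iff']
    ext i j
    have h2 := hP (b (Sum.inr i)) (b (Sum.inr j))
    rw [hPb, hPb] at h2
    have h3 : ∀ l l', B (b (Sum.inr l)) (b (Sum.inr l')) = if l = l' then 1 else 0 := by
      intro l l'
      split_ifs with hl
      · rw [hl, h1]
      · exact h _ _ (by simpa using hl)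
    simp only [map_sum, map_smul, LinearMap.sum_apply, LinearMap.smul_apply, h3, smul_eq_mul,
      mul_ite, mul_one, mul_zero, Finset.sum_ite_eq', Finset.mem_univ, if_true] at h2
    simp only [Matrix.mul_apply, Matrix.transpose_apply, Matrix.one_apply]
    rw [← h2]
    refine Finset.sum_congr rfl fun l _ ↦ ?_
    ring
  have hdetA : M.toBlocks₂₂.det = LinearMap.det P := by
    rw [← LinearMap.det_toMatrix b, ← hM]
    conv_rhs => rw [hblock]
    simp
  refine Matrix.mem_specialOrthogonalGroup_iff.2 ⟨horth, ?_⟩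
  have h4 := congrArg Matrix.det ((Matrix.mem_orthogonalGroup_iff' _ _).1 horth)
  simp only [Matrix.det_mul, Matrix.det_transpose, Matrix.det_one] at h4
  rw [← hdetA] at hdet
  nlinarith

/-- Linear maps that preserve a Euclidean inner product, a Lorentz form and one of its timecones
have a common timelike fixed vector: the vector of least Euclidean norm in the closed convex set of
all vectors of square at most `-1` in the timecone. -/
lemma exists_timelike_fixed {ι : Type*} [Fintype ι] [DecidableEq ι] {B : LinearMap.BilinForm ℝ V}
    (hB : IsLorentzForm B) (b : Module.Basis ι ℝ V) (H : Set (V →ₗ[ℝ] V))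
    (horth : ∀ P ∈ H, LinearMap.toMatrix b b P ∈ Matrix.orthogonalGroup ι ℝ)
    (hiso : ∀ P ∈ H, ∀ v w, B (P v) (P w) = B v w) {t : V} (ht : B t t < 0)
    (hcone : ∀ P ∈ H, ∀ v, B v v < 0 → B v t < 0 → B (P v) t < 0) :
    ∃ u, B u u < 0 ∧ ∀ P ∈ H, P u = u := by
  let φ : EuclideanSpace ℝ ι ≃ₗ[ℝ] V := (WithLp.linearEquiv 2 ℝ (ι → ℝ)).trans b.equivFun.symm
  let B' : EuclideanSpace ℝ ι →ₗ[ℝ] EuclideanSpace ℝ ι →ₗ[ℝ] ℝ := B.compl₁₂ φ.toLinearMap φ.toLinearMap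
  let K : Set (EuclideanSpace ℝ ι) := {x | B (φ x) (φ x) ≤ -1 ∧ B (φ x) t ≤ 0}
  have hneg : ∀ x ∈ K, B (φ x) t < 0 := fun x hx ↦
    lt_of_le_of_ne hx.2 (hB.ne_zero_of_timelike (by linarith [hx.1]) ht)
  have hne : K.Nonempty := by
    refine ⟨φ.symm ((√(-B t t))⁻¹ • t), ?_, ?_⟩
    · have h1 := Real.mul_self_sqrt (neg_pos.2 ht).le
      have h2 := (Real.sqrt_pos.2 (neg_pos.2 ht)).ne'
      simp only [LinearEquiv.apply_symm_apply, map_smul, LinearMap.smul_apply, smul_eq_mul]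
      refine le_of_eq ?_
      field_simp
      linarith
    · simp only [LinearEquiv.apply_symm_apply, map_smul, LinearMap.smul_apply, smul_eq_mul]
      exact mul_nonpos_of_nonneg_of_nonpos (by positivity) ht.le
  have hclosed : IsClosed K := by
    have h1 : Continuous fun x ↦ B (φ x) (φ x) := by
      have : Continuous fun x ↦ (LinearMap.toContinuousLinearMap
        ((LinearMap.toContinuousLinearMap).toLinearMap ∘ₗ B')) x x := by fun_prop
      exact this
    have h2 : Continuous fun x ↦ B (φ x) t :=
      (LinearMap.toContinuousLinearMap ((B.flip t) ∘ₗ φ.toLinearMap)).continuous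
    exact (isClosed_le h1 continuous_const).inter (isClosed_le h2 continuous_const)
  have hconv : Convex ℝ K := by
    intro x hx y hy r s hr hs hrs
    have hxy : B (φ x) (φ y) ≤ -1 := by
      have hx1 : B (φ x) (φ x) < 0 := by linarith [hx.1]
      have h1 := hB.neg_of_neg ht hx1 (by linarith [hy.1]) (hneg x hx) (hneg y hy)
      have h2 := hB.mul_le_sq hx1 (φ y)
      have h3 : 1 ≤ B (φ x) (φ x) * B (φ y) (φ y) := by nlinarith [hx.1, hy.1]
      nlinarith
    constructor
    · simp only [map_add, map_smul, LinearMap.add_apply, LinearMap.smul_apply, smul_eq_mul,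
        hB.1 (φ y) (φ x)]
      have h1 : s = 1 - r := by linarith
      have h2 := mul_nonneg (mul_self_nonneg r) (sub_nonneg.2 hx.1)
      have h3 := mul_nonneg (mul_self_nonneg s) (sub_nonneg.2 hy.1)
      have h4 := mul_nonneg (mul_nonneg hr hs) (sub_nonneg.2 hxy)
      subst h1
      nlinarith
    · simp only [map_add, map_smul, LinearMap.add_apply, LinearMap.smul_apply, smul_eq_mul]
      exact add_nonpos (mul_nonpos_of_nonneg_of_nonpos hr hx.2)
        (mul_nonpos_of_nonneg_of_nonpos hs hy.2)
  obtain ⟨x, hxK, hx⟩ := exists_norm_eq_iInf_of_complete_convex hne hclosed.isComplete hconv 0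
  rw [norm_eq_iInf_iff_real_inner_le_zero hconv hxK] at hx
  refine ⟨φ x, by linarith [hxK.1], fun P hP ↦ ?_⟩
  obtain ⟨y, hy⟩ := φ.surjective (P (φ x))
  have hyK : y ∈ K := by
    have h1 : B (φ x) (φ x) < 0 := by linarith [hxK.1]
    change B (φ y) (φ y) ≤ -1 ∧ B (φ y) t ≤ 0
    rw [hy, hiso P hP]
    exact ⟨hxK.1, (hcone P hP _ h1 (hneg x hxK)).le⟩
  have hyx : inner ℝ y y = inner ℝ x x := by
    have h1 : ∀ z : EuclideanSpace ℝ ι, b.equivFun (φ z) = z.ofLp := fun z ↦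
      b.equivFun.apply_symm_apply _
    have h2 : y.ofLp = (LinearMap.toMatrix b b P).mulVec x.ofLp := by
      rw [← h1, ← h1, hy, Module.Basis.equivFun_apply, Module.Basis.equivFun_apply,
        LinearMap.toMatrix_mulVec_repr]
    have h3 := (Matrix.mem_orthogonalGroup_iff' _ _).1 (horth P hP)
    rw [EuclideanSpace.inner_eq_star_dotProduct, EuclideanSpace.inner_eq_star_dotProduct, h2]
    simp only [star_trivial]
    rw [Matrix.dotProduct_mulVec, Matrix.vecMul_mulVec, h3, Matrix.vecMul_one]
  have h5 := hx y hyK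
  have h6 : inner ℝ (x - y) (x - y) ≤ 0 := by
    simp only [zero_sub, inner_sub_left, inner_sub_right, inner_neg_left,
      real_inner_comm x y] at h5 ⊢
    linarith
  have h7 : x - y = 0 := real_inner_self_nonpos.1 h6
  rw [← hy, ← sub_eq_zero.1 h7]

end LinearAlgebra

/-! ### Parallel fields along curves -/

section Curves

variable {m : ℕ} {M : Type*} [TopologicalSpace M]
  [ChartedSpace (EuclideanSpace ℝ (Fin m)) M] [IsManifold (𝓡 m) ∞ M]

local notation "Em" => EuclideanSpace ℝ (Fin m)

lemma hasDerivWithinAt_clm_comp_apply {F W : Type*} [NormedAddCommGroup F] [NormedSpace ℝ F]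
    [NormedAddCommGroup W] [NormedSpace ℝ W] {D : F → F →L[ℝ] W} {D' : F →L[ℝ] F →L[ℝ] W}
    {u ξ : ℝ → F} {u' ξ' : F} {s : Set ℝ} {t : ℝ} (hD : HasFDerivAt D D' (u t))
    (hu : HasDerivWithinAt u u' s t) (hξ : HasDerivWithinAt ξ ξ' s t) :
    HasDerivWithinAt (fun s ↦ D (u s) (ξ s)) (D' u' (ξ t) + D (u t) ξ') s t :=
  (hD.comp_hasDerivWithinAt t hu).clm_apply hξ

lemma hasDerivWithinAt_bilin_comp_apply {F : Type*} [NormedAddCommGroup F] [NormedSpace ℝ F]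
    {G : F → F →L[ℝ] F →L[ℝ] ℝ} {u ξ η : ℝ → F} {u' ξ' η' : F} {s : Set ℝ} {t : ℝ}
    (hG : DifferentiableAt ℝ G (u t)) (hu : HasDerivWithinAt u u' s t)
    (hξ : HasDerivWithinAt ξ ξ' s t) (hη : HasDerivWithinAt η η' s t) :
    HasDerivWithinAt (fun s ↦ G (u s) (ξ s) (η s))
      (fderiv ℝ G (u t) u' (ξ t) (η t) + G (u t) ξ' (η t) + G (u t) (ξ t) η') s t :=
  (hasDerivWithinAt_clm_comp_apply hG.hasFDerivAt hu hξ).clm_apply hη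

lemma uniqueDiffWithinAt_Icc {t : ℝ} (ht : t ∈ Icc (0 : ℝ) 1) :
    UniqueDiffWithinAt ℝ (Icc (0 : ℝ) 1) t :=
  uniqueDiffOn_Icc zero_lt_one t ht

/-- The coordinates of a smooth curve are differentiable. -/
lemma hasDerivWithinAt_chart {γ : ℝ → M} (hγ : ContMDiffOn 𝓘(ℝ, ℝ) (𝓡 m) ∞ γ (Icc 0 1))
    {t : ℝ} (ht : t ∈ Icc (0 : ℝ) 1) {x : M} (hx : γ t ∈ (extChartAt (𝓡 m) x).source) :
    HasDerivWithinAt (fun s ↦ extChartAt (𝓡 m) x (γ s))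
      (derivWithin (fun s ↦ extChartAt (𝓡 m) x (γ s)) (Icc 0 1) t) (Icc 0 1) t := by
  have h1 : ContMDiffAt (𝓡 m) 𝓘(ℝ, Em) ∞ (extChartAt (𝓡 m) x) (γ t) :=
    contMDiffAt_extChartAt' (by simpa using hx)
  have h2 := (h1.comp_contMDiffWithinAt t (hγ t ht)).contDiffWithinAt
  exact (h2.differentiableWithinAt (by simp)).hasDerivWithinAt

/-- The equation of parallelism along `γ`, at time `t` and in the chart around `x`. -/
def IsParallelInChart (g : LorentzianMetric m M) (γ : ℝ → M)
    (X : ∀ t : ℝ, TangentSpace (𝓡 m) (γ t)) (x : M) (t : ℝ) : Prop :=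
  HasDerivWithinAt (fun s ↦ chartVector x (X s))
    (-christoffel g x (extChartAt (𝓡 m) x (γ t))
      (derivWithin (fun s ↦ extChartAt (𝓡 m) x (γ s)) (Icc 0 1) t) (chartVector x (X t)))
    (Icc 0 1) t

/-- The equation of parallelism does not depend on the chart. -/
lemma IsParallelInChart.change {g : LorentzianMetric m M} {γ : ℝ → M}
    (hγ : ContMDiffOn 𝓘(ℝ, ℝ) (𝓡 m) ∞ γ (Icc 0 1)) {X : ∀ t : ℝ, TangentSpace (𝓡 m) (γ t)}
    {x x' : M} {t : ℝ} (ht : t ∈ Icc (0 : ℝ) 1) (hx : γ t ∈ (extChartAt (𝓡 m) x).source)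
    (hx' : γ t ∈ (extChartAt (𝓡 m) x').source) (h : IsParallelInChart g γ X x t) :
    IsParallelInChart g γ X x' t := by
  have hleft : ∀ {s}, γ s ∈ (extChartAt (𝓡 m) x).source →
      (extChartAt (𝓡 m) x).symm (extChartAt (𝓡 m) x (γ s)) = γ s :=
    fun hs ↦ (extChartAt (𝓡 m) x).left_inv hs
  have hmem : ∀ {s}, γ s ∈ (extChartAt (𝓡 m) x).source → γ s ∈ (extChartAt (𝓡 m) x').source →
      extChartAt (𝓡 m) x (γ s) ∈ chartOverlap x x' := fun hs hs' ↦
    ⟨(extChartAt (𝓡 m) x).map_source hs, by simpa only [mem_preimage, hleft hs] using hs'⟩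
  have hvec : ∀ {s}, γ s ∈ (extChartAt (𝓡 m) x).source → γ s ∈ (extChartAt (𝓡 m) x').source →
      chartVector x' (X s) =
        fderiv ℝ (chartChange x x') (extChartAt (𝓡 m) x (γ s)) (chartVector x (X s)) := by
    intro s hs hs'
    have h1 := hmem hs hs'
    generalize X s = v
    revert v
    rw [← hleft hs]
    intro v
    rw [(extChartAt (𝓡 m) x).right_inv h1.1, chartVector_eq_fderiv_chartChange h1]
  have hev : ∀ᶠ s in 𝓝[Icc 0 1] t, γ s ∈ (extChartAt (𝓡 m) x).source ∧
      γ s ∈ (extChartAt (𝓡 m) x').source :=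
    ((hγ.continuousOn t ht).eventually_mem ((isOpen_extChartAt_source x).mem_nhds hx)).and
      ((hγ.continuousOn t ht).eventually_mem ((isOpen_extChartAt_source x').mem_nhds hx'))
  have hu := hasDerivWithinAt_chart hγ ht hx
  set y := extChartAt (𝓡 m) x (γ t)
  set u' := derivWithin (fun s ↦ extChartAt (𝓡 m) x (γ s)) (Icc 0 1) t
  have hy : y ∈ chartOverlap x x' := hmem hx hx'
  have hcy : chartChange x x' y = extChartAt (𝓡 m) x' (γ t) := by
    simp only [chartChange, Function.comp_apply, y, hleft hx]
  -- the velocity in the chart around `x'`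
  have hu2 : HasDerivWithinAt (fun s ↦ extChartAt (𝓡 m) x' (γ s))
      (fderiv ℝ (chartChange x x') y u') (Icc 0 1) t := by
    refine ((hasFDerivAt_chartChange hy).comp_hasDerivWithinAt t hu).congr_of_eventuallyEq ?_ ?_
    · filter_upwards [hev] with s hs
      simp only [chartChange, Function.comp_apply, hleft hs.1]
    · exact hcy.symm
  -- the derivative of the components in the chart around `x'`
  have hξ := hasDerivWithinAt_clm_comp_apply (hasFDerivAt_fderiv_chartChange hy) hu h
  unfold IsParallelInChart
  rw [hu2.derivWithin (uniqueDiffWithinAt_Icc ht), ← hcy, hvec hx hx']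
  refine (hξ.congr_of_eventuallyEq ?_ (hvec hx hx')).congr_deriv ?_
  · filter_upwards [hev] with s hs using hvec hs.1 hs.2
  · have h2 := christoffel_chartChange g hy u' (chartVector x (X t))
    rw [map_neg, ← h2]
    abel

/-- The inner product of two parallel fields along a curve is constant. -/
lemma IsParallelAlong.val_eq {g : LorentzianMetric m M} {γ : ℝ → M}
    (hγ : ContMDiffOn 𝓘(ℝ, ℝ) (𝓡 m) ∞ γ (Icc 0 1)) {X Y : ∀ t : ℝ, TangentSpace (𝓡 m) (γ t)}
    (hX : IsParallelAlong g γ X) (hY : IsParallelAlong g γ Y) {t : ℝ} (ht : t ∈ Icc (0 : ℝ) 1) :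
    g.val (γ t) (X t) (Y t) = g.val (γ 0) (X 0) (Y 0) := by
  have key : ∀ t ∈ Icc (0 : ℝ) 1,
      HasDerivWithinAt (fun s ↦ g.val (γ s) (X s) (Y s)) 0 (Icc 0 1) t := by
    intro t ht
    have hev : ∀ᶠ s in 𝓝[Icc 0 1] t, γ s ∈ (extChartAt (𝓡 m) (γ t)).source :=
      (hγ.continuousOn t ht).eventually_mem
        ((isOpen_extChartAt_source (γ t)).mem_nhds (mem_extChartAt_source (γ t)))
    have hu := hasDerivWithinAt_chart hγ ht (mem_extChartAt_source (I := 𝓡 m) (γ t))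
    have htar := mem_extChartAt_target (I := 𝓡 m) (γ t)
    have h1 := hasDerivWithinAt_bilin_comp_apply (differentiableAt_chartMetric g (γ t) htar)
      hu (hX t ht) (hY t ht)
    refine (h1.congr_of_eventuallyEq ?_ ?_).congr_deriv ?_
    · filter_upwards [hev] with s hs using (chartMetric_chartVector g hs _ _).symm
    · exact (chartMetric_chartVector g (mem_extChartAt_source (γ t)) _ _).symm
    · rw [fderiv_chartMetric g (γ t) htar, map_neg, map_neg, neg_apply]
      ring
  exact constant_of_derivWithin_zero (fun t ht ↦ (key t ht).differentiableWithinAt)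
    (fun t ht ↦ (key t (Ico_subset_Icc_self ht)).derivWithin
      (uniqueDiffWithinAt_Icc (Ico_subset_Icc_self ht))) t ht

/-- Parallel vector fields are parallel along every curve. -/
lemma IsParallelField.isParallelAlong {g : LorentzianMetric m M}
    {V : ∀ x : M, TangentSpace (𝓡 m) x} (hV : IsParallelField g V) {γ : ℝ → M}
    (hγ : ContMDiffOn 𝓘(ℝ, ℝ) (𝓡 m) ∞ γ (Icc 0 1)) : IsParallelAlong g γ (fun t ↦ V (γ t)) := by
  intro t ht
  have hu := hasDerivWithinAt_chart hγ ht (mem_extChartAt_source (I := 𝓡 m) (γ t))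
  have hd := ((contDiffAt_chartVector V (γ t) hV.1.contMDiffAt).differentiableAt
    (by simp)).hasFDerivAt
  refine ((hd.comp_hasDerivWithinAt t hu).congr_of_eventuallyEq ?_ ?_).congr_deriv ?_
  · filter_upwards [(hγ.continuousOn t ht).eventually_mem
      ((isOpen_extChartAt_source (I := 𝓡 m) (γ t)).mem_nhds (mem_extChartAt_source (γ t)))] with s hs
    simp only [Function.comp_apply]
    rw [(extChartAt (𝓡 m) (γ t)).left_inv hs]
  · simp only [Function.comp_apply]
    rw [extChartAt_to_inv (I := 𝓡 m)]
  · exact eq_neg_of_add_eq_zero_left (hV.2 (γ t) _)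

/-- A property of the points of `[0, 1]` whose truth is locally constant is constant. -/
lemma iff_of_locally_constant_Icc {A : ℝ → Prop}
    (h : ∀ t ∈ Icc (0 : ℝ) 1, ∀ᶠ s in 𝓝[Icc 0 1] t, (A s ↔ A t)) : A 0 ↔ A 1 := by
  have h1 : IsLocallyConstant (fun t : Icc (0 : ℝ) 1 ↦ A t) := by
    rw [IsLocallyConstant.iff_eventually_eq]
    rintro ⟨t, ht⟩
    have h2 := h t ht
    rw [← map_nhds_subtype_val ⟨t, ht⟩] at h2
    exact (Filter.eventually_map.1 h2).mono fun s hs ↦ propext hs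
  exact (h1.apply_eq_of_preconnectedSpace ⟨0, by simp⟩ ⟨1, by simp⟩).to_iff

end Curves

/-! ### What parallel transport preserves -/

section Transport

variable {m : ℕ} {M : Type*} [TopologicalSpace M]
  [ChartedSpace (EuclideanSpace ℝ (Fin m)) M] [IsManifold (𝓡 m) ∞ M]

local notation "Em" => EuclideanSpace ℝ (Fin m)

/-- The metric at a point as an algebraic bilinear form. -/
def LorentzianMetric.form (g : LorentzianMetric m M) (x : M) :
    LinearMap.BilinForm ℝ (TangentSpace (𝓡 m) x) :=
  LinearMap.mk₂ ℝ (fun v w ↦ g.val x v w) (fun _ _ _ ↦ by simp) (fun _ _ _ ↦ by simp)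
    (fun _ _ _ ↦ by simp) (fun _ _ _ ↦ by simp)

@[simp]
lemma LorentzianMetric.form_apply (g : LorentzianMetric m M) (x : M)
    (v w : TangentSpace (𝓡 m) x) : g.form x v w = g.val x v w := rfl

lemma LorentzianMetric.isLorentzForm (g : LorentzianMetric m M) (x : M) :
    IsLorentzForm (g.form x) :=
  ⟨g.symm x, m, g.signature x⟩

lemma finrank_tangentSpace (x : M) : Module.finrank ℝ (TangentSpace (𝓡 m) x) = m := by
  change Module.finrank ℝ Em = m
  simp

instance (x : M) : FiniteDimensional ℝ (TangentSpace (𝓡 m) x) :=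
  inferInstanceAs (FiniteDimensional ℝ Em)

/-- Parallel transport is isometric. -/
lemma IsParallelTransport.val_eq {g : LorentzianMetric m M} {p q : M}
    {P : TangentSpace (𝓡 m) p →ₗ[ℝ] TangentSpace (𝓡 m) q} (h : IsParallelTransport g P)
    (v w : TangentSpace (𝓡 m) p) : g.val q (P v) (P w) = g.val p v w := by
  induction h with
  | smooth P γ hγ h0 h1 hP =>
    subst h0 h1
    obtain ⟨X, hX, hX0, hX1⟩ := hP v
    obtain ⟨Y, hY, hY0, hY1⟩ := hP w
    rw [TotalSpace.mk_inj] at hX0 hX1 hY0 hY1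
    rw [← hX1, ← hY1, ← hX0, ← hY0]
    exact hX.val_eq hγ hY (by simp)
  | comp P Q hP hQ ihP ihQ => simp only [LinearMap.comp_apply, ihP, ihQ]

/-- Parallel transport is bijective. -/
lemma IsParallelTransport.exists_equiv {g : LorentzianMetric m M} {p q : M}
    {P : TangentSpace (𝓡 m) p →ₗ[ℝ] TangentSpace (𝓡 m) q} (h : IsParallelTransport g P) :
    ∃ e : TangentSpace (𝓡 m) p ≃ₗ[ℝ] TangentSpace (𝓡 m) q, ∀ v, e v = P v := by
  have hinj : Function.Injective P := by
    refine (injective_iff_map_eq_zero _).2 fun v hv ↦ g.nondegenerate p v fun w ↦ ?_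
    rw [← h.val_eq, hv, map_zero, zero_apply]
  exact ⟨LinearEquiv.ofInjectiveOfFinrankEq P hinj
    ((finrank_tangentSpace p).trans (finrank_tangentSpace q).symm), fun _ ↦ rfl⟩

/-- Parallel transport maps the values of a parallel vector field to each other. This is the
uniqueness of parallel fields along a curve: the inner products of two of them with all parallel
fields are constant. -/
lemma IsParallelTransport.apply_field {g : LorentzianMetric m M} {p q : M}
    {P : TangentSpace (𝓡 m) p →ₗ[ℝ] TangentSpace (𝓡 m) q} (h : IsParallelTransport g P)
    {V : ∀ x : M, TangentSpace (𝓡 m) x} (hV : IsParallelField g V) : P (V p) = V q := by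
  induction h with
  | smooth P γ hγ h0 h1 hP =>
    have hPT := IsParallelTransport.smooth (g := g) P γ hγ h0 h1 hP
    subst h0 h1
    obtain ⟨e, he⟩ := hPT.exists_equiv
    refine sub_eq_zero.1 (g.nondegenerate _ _ fun w' ↦ ?_)
    obtain ⟨w, rfl⟩ := e.surjective w'
    obtain ⟨Y, hY, hY0, hY1⟩ := hP w
    rw [TotalSpace.mk_inj] at hY0 hY1
    have h2 := (hV.isParallelAlong hγ).val_eq hγ hY (t := 1) (by simp)
    rw [he, map_sub, sub_apply, hPT.val_eq, ← hY1, h2, hY0, sub_self]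
  | comp P Q hP hQ ihP ihQ => simp only [LinearMap.comp_apply, ihP, ihQ]

lemma IsParallelAlong.continuousWithinAt {g : LorentzianMetric m M} {γ : ℝ → M}
    {X : ∀ t : ℝ, TangentSpace (𝓡 m) (γ t)} (hX : IsParallelAlong g γ X) {t : ℝ}
    (ht : t ∈ Icc (0 : ℝ) 1) :
    ContinuousWithinAt (fun s ↦ chartVector (γ t) (X s)) (Icc 0 1) t :=
  (hX t ht).continuousWithinAt

/-- The sign of a continuous function is locally constant at points that are not zeros. -/
lemma eventually_pos_iff {f : ℝ → ℝ} {s : Set ℝ} {t : ℝ} (hf : ContinuousWithinAt f s t)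
    (h0 : f t ≠ 0) : ∀ᶠ r in 𝓝[s] t, (0 < f r ↔ 0 < f t) := by
  rcases h0.lt_or_gt with h | h
  · filter_upwards [hf.eventually_lt continuousWithinAt_const h] with r hr
    exact ⟨fun h' ↦ absurd h' hr.not_gt, fun h' ↦ absurd h' h.not_gt⟩
  · filter_upwards [continuousWithinAt_const.eventually_lt hf h] with r hr
    exact ⟨fun _ ↦ h, fun _ ↦ hr⟩

/-- Parallel transport preserves time orientations. -/
lemma IsParallelTransport.mem_cone {g : LorentzianMetric m M}
    {C : ∀ x : M, Set (TangentSpace (𝓡 m) x)} (hC : IsTimeOrientation g C) {p q : M}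
    {P : TangentSpace (𝓡 m) p →ₗ[ℝ] TangentSpace (𝓡 m) q} (h : IsParallelTransport g P)
    {v : TangentSpace (𝓡 m) p} (hv : v ∈ C p) : P v ∈ C q := by
  induction h with
  | smooth P γ hγ h0 h1 hP =>
    subst h0 h1
    obtain ⟨X, hX, hX0, hX1⟩ := hP v
    rw [TotalSpace.mk_inj] at hX0 hX1
    have htime : ∀ t ∈ Icc (0 : ℝ) 1, g.val (γ t) (X t) (X t) < 0 := by
      intro t ht
      rw [hX.val_eq hγ hX ht, hX0]
      obtain ⟨U, hU, T, -, hT⟩ := hC (γ 0)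
      rw [(hT _ (mem_of_mem_nhds hU)).2] at hv
      exact hv.1
    have hloc := iff_of_locally_constant_Icc (A := fun t ↦ X t ∈ C (γ t)) (by
      intro t ht
      obtain ⟨U, hU, T, hTc, hT⟩ := hC (γ t)
      have hUt := mem_of_mem_nhds hU
      have hγt := hγ.continuousOn t ht
      have hx := mem_extChartAt_source (I := 𝓡 m) (γ t)
      have hTγ : ContinuousWithinAt (fun s ↦ (⟨γ s, T (γ s)⟩ : TangentBundle (𝓡 m) M))
          (Icc 0 1) t := (hTc.continuousAt hU).comp_continuousWithinAt
            (f := γ) (g := fun x ↦ (⟨x, T x⟩ : TangentBundle (𝓡 m) M)) hγt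
      have hτ := continuousWithinAt_chartVector (x := γ t) hx hTγ
      have hu := (hasDerivWithinAt_chart hγ ht hx).continuousWithinAt
      have hG := (differentiableAt_chartMetric g (γ t)
        (mem_extChartAt_target (γ t))).continuousAt.comp_continuousWithinAt
          (f := fun s ↦ extChartAt (𝓡 m) (γ t) (γ s)) hu
      have hf : ContinuousWithinAt (fun s ↦ -chartMetric g (γ t) (extChartAt (𝓡 m) (γ t) (γ s))
          (chartVector (γ t) (X s)) (chartVector (γ t) (T (γ s)))) (Icc 0 1) t :=
        ((hG.clm_apply (hX.continuousWithinAt ht)).clm_apply hτ).neg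
      have hval : ∀ {s}, γ s ∈ (extChartAt (𝓡 m) (γ t)).source →
          -chartMetric g (γ t) (extChartAt (𝓡 m) (γ t) (γ s))
          (chartVector (γ t) (X s)) (chartVector (γ t) (T (γ s))) =
            -g.val (γ s) (X s) (T (γ s)) := fun hs ↦
        congrArg Neg.neg (chartMetric_chartVector g hs _ _)
      have hne := (g.isLorentzForm (γ t)).ne_zero_of_timelike (htime t ht) (hT _ hUt).1
      have hev := eventually_pos_iff hf (by rw [hval hx]; exact neg_ne_zero.2 hne)
      filter_upwards [hev, hγt.eventually_mem hU, self_mem_nhdsWithin,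
        hγt.eventually_mem ((isOpen_extChartAt_source (I := 𝓡 m) (γ t)).mem_nhds hx)]
        with s hs hsU hsI hsx
      rw [hval hx, hval hsx, neg_pos, neg_pos] at hs
      rw [(hT _ hUt).2, (hT _ hsU).2]
      simp only [mem_ofPred_eq, htime s hsI, htime t ht, true_and, hs])
    rw [← hX1]
    exact hloc.1 (by rw [hX0]; exact hv)
  | comp P Q hP hQ ihP ihQ => exact ihQ (ihP hv)

lemma orientation_eq_iff_det_mul_det_pos {W : Type*} [AddCommGroup W] [Module ℝ W] {ι : Type*}
    [Fintype ι] [DecidableEq ι] (c b b' : Module.Basis ι ℝ W) :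
    b.orientation = b'.orientation ↔ 0 < c.det b * c.det b' := by
  rw [Module.Basis.orientation_eq_iff_det_pos]
  have h1 : c.det b' = c.det b * b.det b' := by
    conv_lhs => rw [c.det.eq_smul_basis_det b]
    rfl
  have h2 : c.det b ≠ 0 := (c.isUnit_det b).ne_zero
  have h3 : 0 < c.det b * c.det b := mul_self_pos.2 h2
  rw [h1, ← mul_assoc]
  exact (mul_pos_iff_of_pos_left h3).symm

/-- Parallel transport preserves orientations. -/
lemma IsParallelTransport.map_orientation {g : LorentzianMetric m M}
    {o : ∀ x : M, _root_.Orientation ℝ (TangentSpace (𝓡 m) x) (Fin m)} (ho : IsOrientation o)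
    {p q : M} {P : TangentSpace (𝓡 m) p →ₗ[ℝ] TangentSpace (𝓡 m) q}
    (h : IsParallelTransport g P) :
    ∃ e : TangentSpace (𝓡 m) p ≃ₗ[ℝ] TangentSpace (𝓡 m) q, (∀ v, e v = P v) ∧
      Orientation.map (Fin m) e (o p) = o q := by
  induction h with
  | smooth P γ hγ h0 h1 hP =>
    have hPT := IsParallelTransport.smooth (g := g) P γ hγ h0 h1 hP
    subst h0 h1
    obtain ⟨e, he⟩ := hPT.exists_equiv
    refine ⟨e, he, ?_⟩
    obtain ⟨b, hb⟩ : ∃ b : Module.Basis (Fin m) ℝ (TangentSpace (𝓡 m) (γ 0)),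
        b.orientation = o (γ 0) := by
      obtain ⟨U, hU, f, -, hf⟩ := ho (γ 0)
      obtain ⟨b, -, hb⟩ := hf _ (mem_of_mem_nhds hU)
      exact ⟨b, hb⟩
    choose X hX hX0 hX1 using fun i ↦ hP (b i)
    simp only [TotalSpace.mk_inj] at hX0 hX1
    -- the parallel fields extending the basis `b` form a frame along the curve
    have hframe : ∀ t ∈ Icc (0 : ℝ) 1, ∃ B : Module.Basis (Fin m) ℝ (TangentSpace (𝓡 m) (γ t)),
        ∀ i, B i = X i t := by
      intro t ht
      have hli : LinearIndependent ℝ (fun i ↦ X i t) := by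
        rw [Fintype.linearIndependent_iff]
        intro c hc
        refine Fintype.linearIndependent_iff.1 b.linearIndependent c
          (g.nondegenerate _ _ fun w ↦ ?_)
        have h2 : ∀ j, g.val (γ 0) (∑ i, c i • b i) (b j) = 0 := by
          intro j
          have h3 : g.val (γ t) (∑ i, c i • X i t) (X j t) = 0 := by
            rw [hc, map_zero, zero_apply]
          simpa only [map_sum, map_smul, sum_apply, smul_apply, (hX _).val_eq hγ (hX j) ht, hX0]
            using h3
        generalize ∑ i, c i • b i = u at h2
        rw [← b.sum_repr w, map_sum]
        exact Finset.sum_eq_zero fun j _ ↦ by rw [map_smul, h2, smul_zero]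
      exact ⟨Module.Basis.mk hli (hli.span_eq_top_of_card_eq_finrank'
        (by simp [finrank_tangentSpace])).ge, fun i ↦ Module.Basis.mk_apply _ _ i⟩
    have hloc := iff_of_locally_constant_Icc (A := fun t ↦
      ∃ B : Module.Basis (Fin m) ℝ (TangentSpace (𝓡 m) (γ t)),
        (∀ i, B i = X i t) ∧ B.orientation = o (γ t)) (by
      intro t ht
      obtain ⟨U, hU, f, hfc, hf⟩ := ho (γ t)
      have hUt := mem_of_mem_nhds hU
      have hγt := hγ.continuousOn t ht
      have hx := mem_extChartAt_source (I := 𝓡 m) (γ t)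
      let c : Module.Basis (Fin m) ℝ Em := (EuclideanSpace.basisFun (Fin m) ℝ).toBasis
      have hcdet : Continuous fun w : Fin m → Em ↦ c.det w := by
        simp only [Module.Basis.det_apply]
        refine Continuous.matrix_det (continuous_matrix fun i j ↦ ?_)
        exact (c.coord i).continuous_of_finiteDimensional.comp (continuous_apply j)
      have hDX : ContinuousWithinAt (fun s ↦ c.det fun i ↦ chartVector (γ t) (X i s))
          (Icc 0 1) t := hcdet.continuousAt.comp_continuousWithinAt
            (continuousWithinAt_pi.2 fun i ↦ (hX i).continuousWithinAt ht)
      have hDf : ContinuousWithinAt (fun s ↦ c.det fun i ↦ chartVector (γ t) (f i (γ s)))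
          (Icc 0 1) t := hcdet.continuousAt.comp_continuousWithinAt
            (continuousWithinAt_pi.2 fun i ↦ continuousWithinAt_chartVector (x := γ t) hx
              (((hfc i).continuousAt hU).comp_continuousWithinAt (f := γ)
                (g := fun x ↦ (⟨x, f i x⟩ : TangentBundle (𝓡 m) M)) hγt))
      -- the frame is positively oriented iff both determinants have the same sign
      have hiff : ∀ s ∈ Icc (0 : ℝ) 1, γ s ∈ U → γ s ∈ (extChartAt (𝓡 m) (γ t)).source →
          ((∃ B : Module.Basis (Fin m) ℝ (TangentSpace (𝓡 m) (γ s)),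
            (∀ i, B i = X i s) ∧ B.orientation = o (γ s)) ↔
            0 < (c.det fun i ↦ chartVector (γ t) (X i s)) *
              c.det fun i ↦ chartVector (γ t) (f i (γ s))) ∧
          (c.det fun i ↦ chartVector (γ t) (X i s)) *
              (c.det fun i ↦ chartVector (γ t) (f i (γ s))) ≠ 0 := by
        intro s hs hsU hsx
        obtain ⟨b', hb', hbo⟩ := hf _ hsU
        obtain ⟨B, hB⟩ := hframe s hs
        let φ := chartVectorEquiv (γ t) hsx
        have h2 : (fun i ↦ chartVector (γ t) (X i s)) = B.map φ := by
          funext i; simp [φ, hB]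
        have h3 : (fun i ↦ chartVector (γ t) (f i (γ s))) = b'.map φ := by
          funext i; simp [φ, hb']
        rw [h2, h3, ← hbo]
        refine ⟨?_, mul_ne_zero (c.isUnit_det _).ne_zero (c.isUnit_det _).ne_zero⟩
        rw [← orientation_eq_iff_det_mul_det_pos, Module.Basis.orientation_map,
          Module.Basis.orientation_map, (Orientation.map (Fin m) φ).injective.eq_iff]
        refine ⟨fun ⟨B', hB', hBo⟩ ↦ ?_, fun h ↦ ⟨B, hB, h⟩⟩
        rwa [Module.Basis.eq_of_apply_eq (b₁ := B) (b₂ := B') fun i ↦ by rw [hB, hB']]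
      have hev := eventually_pos_iff (hDX.mul hDf) (hiff t ht hUt hx).2
      filter_upwards [hev, hγt.eventually_mem hU, self_mem_nhdsWithin,
        hγt.eventually_mem ((isOpen_extChartAt_source (I := 𝓡 m) (γ t)).mem_nhds hx)]
        with s hs hsU hsI hsx
      exact (hiff s hsI hsU hsx).1.trans (hs.trans (hiff t ht hUt hx).1.symm))
    obtain ⟨B, hB, hBo⟩ := hloc.1 ⟨b, fun i ↦ (hX0 i).symm, hb⟩
    have hB1 : B = b.map e := Module.Basis.eq_of_apply_eq fun i ↦ by
      rw [hB, hX1, Module.Basis.map_apply, he]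
    rw [← hb, ← Module.Basis.orientation_map, ← hB1, hBo]
  | comp P Q hP hQ ihP ihQ =>
    obtain ⟨e, he, heo⟩ := ihP
    obtain ⟨f, hf, hfo⟩ := ihQ
    refine ⟨e.trans f, fun v ↦ by simp [he, hf], ?_⟩
    rw [← hfo, ← heo]
    generalize o _ = a
    induction a using Module.Ray.ind with
    | h v hv => rfl

/-- Holonomies have positive determinant. -/
lemma IsParallelTransport.det_pos {g : LorentzianMetric m M}
    {o : ∀ x : M, _root_.Orientation ℝ (TangentSpace (𝓡 m) x) (Fin m)} (ho : IsOrientation o)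
    {p : M} {P : TangentSpace (𝓡 m) p →ₗ[ℝ] TangentSpace (𝓡 m) p}
    (h : IsParallelTransport g P) : 0 < LinearMap.det P := by
  obtain ⟨e, he, heo⟩ := h.map_orientation ho
  have h1 := (Orientation.map_eq_iff_det_pos (o p) e (by simp [finrank_tangentSpace])).1 heo
  have h2 : (e : TangentSpace (𝓡 m) p →ₗ[ℝ] TangentSpace (𝓡 m) p) = P := LinearMap.ext he
  rwa [h2] at h1

end Transport

/-! ### Existence of parallel transport along short segments -/

section Existence

/-- The fundamental solution of a linear equation. The bound on the coefficients lets the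
Picard-Lindelöf theorem give it on all of `[0, 1]` at once. -/
lemma exists_fundamental_solution {F : Type*} [NormedAddCommGroup F] [NormedSpace ℝ F]
    [CompleteSpace F] {A : ℝ → F →L[ℝ] F} (hA : ContinuousOn A (Icc 0 1))
    (hA2 : ∀ t ∈ Icc (0 : ℝ) 1, ‖A t‖ ≤ 1 / 2) :
    ∃ Φ : ℝ → F →L[ℝ] F, Φ 0 = ContinuousLinearMap.id ℝ F ∧
      ∀ t ∈ Icc (0 : ℝ) 1, HasDerivWithinAt Φ ((A t).comp (Φ t)) (Icc 0 1) t := by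
  -- the solution stays in the ball of radius `2` around the identity
  have hPL : IsPicardLindelof (fun t (Φ : F →L[ℝ] F) ↦ (A t).comp Φ)
      (⟨0, by simp⟩ : Icc (0 : ℝ) 1) (ContinuousLinearMap.id ℝ F) 2 0 2 1 := by
    refine ⟨fun t ht ↦ ?_, fun Φ _ ↦ ?_, fun t ht Φ hΦ ↦ ?_, by simp⟩
    · refine LipschitzOnWith.of_dist_le_mul fun Φ _ Ψ _ ↦ ?_
      rw [dist_eq_norm, dist_eq_norm, ← ContinuousLinearMap.comp_sub]
      refine (ContinuousLinearMap.opNorm_comp_le _ _).trans ?_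
      have := hA2 t ht
      gcongr
      exact this.trans (by norm_num)
    · exact hA.clm_comp continuousOn_const
    · have h1 : ‖Φ‖ ≤ 3 := by
        have h2 : ‖Φ - ContinuousLinearMap.id ℝ F‖ ≤ 2 := by
          simpa [dist_eq_norm] using hΦ
        have h3 := norm_add_le (Φ - ContinuousLinearMap.id ℝ F) (ContinuousLinearMap.id ℝ F)
        rw [sub_add_cancel] at h3
        linarith [ContinuousLinearMap.norm_id_le (𝕜 := ℝ) (E := F)]
      refine (ContinuousLinearMap.opNorm_comp_le _ _).trans ?_
      have := hA2 t ht
      have := norm_nonneg (A t)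
      simp only [NNReal.coe_ofNat]
      nlinarith [norm_nonneg Φ]
  exact hPL.exists_eq_forall_mem_Icc_hasDerivWithinAt₀

variable {m : ℕ} {M : Type*} [TopologicalSpace M]
  [ChartedSpace (EuclideanSpace ℝ (Fin m)) M] [IsManifold (𝓡 m) ∞ M]

local notation "Em" => EuclideanSpace ℝ (Fin m)

/-- A ball in a chart that is so small that the equation of parallelism can be solved along all of
its segments, whose velocities `v` have norm at most `2 * ρ`. -/
def IsTransportBall (g : LorentzianMetric m M) (x : M) (ρ : ℝ) : Prop :=
  0 < ρ ∧ Metric.ball (extChartAt (𝓡 m) x x) ρ ⊆ (extChartAt (𝓡 m) x).target ∧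
    ∀ y ∈ Metric.ball (extChartAt (𝓡 m) x x) ρ, ∀ v : Em, ‖v‖ ≤ 2 * ρ →
      ‖christoffelL g x y v‖ ≤ 1 / 2

lemma exists_isTransportBall (g : LorentzianMetric m M) (x : M) : ∃ ρ, IsTransportBall g x ρ := by
  have hc : ContinuousAt (christoffelL g x) (extChartAt (𝓡 m) x x) :=
    (contDiffOn_christoffelL g x).continuousOn.continuousAt
      ((isOpen_chartTarget x).mem_nhds (mem_extChartAt_target x))
  set K := ‖christoffelL g x (extChartAt (𝓡 m) x x)‖ + 1
  have hK : 0 < K := by positivity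
  have h1 : ∀ᶠ y in 𝓝 (extChartAt (𝓡 m) x x), ‖christoffelL g x y‖ < K :=
    hc.norm.eventually_lt continuousAt_const (by simp [K])
  obtain ⟨r, hr, hball⟩ := Metric.eventually_nhds_iff_ball.1
    (h1.and ((isOpen_chartTarget x).mem_nhds (mem_extChartAt_target x)))
  refine ⟨min r (1 / (4 * K)), by positivity, fun y hy ↦
    (hball y (Metric.ball_subset_ball (min_le_left _ _) hy)).2, fun y hy v hv ↦ ?_⟩
  have h2 := (hball y (Metric.ball_subset_ball (min_le_left _ _) hy)).1
  calc ‖christoffelL g x y v‖ ≤ ‖christoffelL g x y‖ * ‖v‖ := ContinuousLinearMap.le_opNorm _ _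
    _ ≤ K * (2 * (1 / (4 * K))) := by
      gcongr
      exact hv.trans (by gcongr; exact min_le_right _ _)
    _ = 1 / 2 := by field_simp; norm_num

/-- The equation of parallelism along the segment from `y` to `y + v` in the chart around `x`, for
linear maps in place of vectors. -/
def IsSegmentSolution (g : LorentzianMetric m M) (x : M) (y v : Em) (Φ : ℝ → Em →L[ℝ] Em) : Prop :=
  Φ 0 = ContinuousLinearMap.id ℝ Em ∧ ∀ t ∈ Icc (0 : ℝ) 1,
    HasDerivWithinAt Φ ((-christoffelL g x (y + t • v) v).comp (Φ t)) (Icc 0 1) t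

/-- The value at time `1` of a solution is a parallel transport. -/
lemma IsSegmentSolution.isParallelTransport {g : LorentzianMetric m M} {x : M} {y v : Em}
    {Φ : ℝ → Em →L[ℝ] Em} (hΦ : IsSegmentSolution g x y v Φ)
    (htar : ∀ t ∈ Icc (0 : ℝ) 1, y + t • v ∈ (extChartAt (𝓡 m) x).target) :
    IsParallelTransport g ((coordVector x (y + v)).toLinearMap ∘ₗ (Φ 1).toLinearMap ∘ₗ
      (chartVectorL x ((extChartAt (𝓡 m) x).symm y)).toLinearMap) := by
  let γ : ℝ → M := fun t ↦ (extChartAt (𝓡 m) x).symm (y + t • v)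
  have hγ : ContMDiffOn 𝓘(ℝ, ℝ) (𝓡 m) ∞ γ (Icc 0 1) := by
    refine (contMDiffOn_extChartAt_symm x).comp ?_ htar
    exact (ContDiff.contMDiff (by fun_prop)).contMDiffOn
  have hsrc : ∀ t ∈ Icc (0 : ℝ) 1, γ t ∈ (extChartAt (𝓡 m) x).source := fun t ht ↦
    (extChartAt (𝓡 m) x).map_target (htar t ht)
  have hγe : ∀ t ∈ Icc (0 : ℝ) 1, extChartAt (𝓡 m) x (γ t) = y + t • v := fun t ht ↦
    (extChartAt (𝓡 m) x).right_inv (htar t ht)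
  refine .smooth _ γ hγ (by simp [γ]) (by simp [γ]) fun w ↦
    ⟨fun t ↦ coordVector x (y + t • v) (Φ t (chartVector x w)), fun t ht ↦ ?_, ?_, ?_⟩
  · refine IsParallelInChart.change hγ ht (hsrc t ht) (mem_extChartAt_source _) ?_
    have hu : HasDerivWithinAt (fun s ↦ extChartAt (𝓡 m) x (γ s)) v (Icc 0 1) t := by
      have h1 : HasDerivWithinAt (fun s : ℝ ↦ y + s • v) ((1 : ℝ) • v) (Icc 0 1) t :=
        ((hasDerivWithinAt_id t _).smul_const v).const_add y
      rw [one_smul] at h1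
      exact h1.congr hγe (hγe t ht)
    have hX : ∀ s ∈ Icc (0 : ℝ) 1, chartVector x (z := γ s)
        (coordVector x (y + s • v) (Φ s (chartVector x w))) = Φ s (chartVector x w) :=
      fun s hs ↦ chartVector_coordVector x (htar s hs) _
    unfold IsParallelInChart
    rw [hu.derivWithin (uniqueDiffWithinAt_Icc ht), hγe t ht, hX t ht]
    have h2 := (hΦ.2 t ht).clm_apply (hasDerivWithinAt_const t (Icc 0 1) (chartVector x w))
    refine (h2.congr hX (hX t ht)).congr_deriv ?_
    simp [christoffelL_apply]
  · let f : Em → Em → TangentBundle (𝓡 m) M := fun y u ↦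
      ⟨(extChartAt (𝓡 m) x).symm y, coordVector x y u⟩
    change f (y + (0 : ℝ) • v) (Φ 0 (chartVector x w)) = _
    rw [zero_smul, add_zero, hΦ.1, ContinuousLinearMap.id_apply, TotalSpace.mk_inj]
    exact coordVector_chartVector x (by simpa using htar 0 (by simp)) w
  · let f : Em → Em → TangentBundle (𝓡 m) M := fun y u ↦
      ⟨(extChartAt (𝓡 m) x).symm y, coordVector x y u⟩
    change f (y + (1 : ℝ) • v) (Φ 1 (chartVector x w)) = f (y + v) (Φ 1 (chartVector x w))
    rw [one_smul]

/-- Reparametrization: a solution along a segment restricts to solutions along its initial parts. -/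
lemma IsSegmentSolution.rescale {g : LorentzianMetric m M} {x : M} {y v : Em}
    {Φ : ℝ → Em →L[ℝ] Em} (hΦ : IsSegmentSolution g x y v Φ) {s : ℝ} (hs : s ∈ Icc (0 : ℝ) 1) :
    IsSegmentSolution g x y (s • v) (fun t ↦ Φ (s * t)) := by
  refine ⟨by simp [hΦ.1], fun t ht ↦ ?_⟩
  have hmaps : MapsTo (fun t ↦ s * t) (Icc (0 : ℝ) 1) (Icc 0 1) := fun t ht ↦
    ⟨mul_nonneg hs.1 ht.1, mul_le_one₀ hs.2 ht.1 ht.2⟩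
  have h1 : HasDerivWithinAt (fun t ↦ s * t) s (Icc 0 1) t := by
    simpa using (hasDerivWithinAt_id t (Icc (0 : ℝ) 1)).const_mul s
  refine ((hΦ.2 (s * t) (hmaps ht)).scomp t h1 hmaps).congr_deriv ?_
  ext1 w
  simp [smul_smul, mul_comm]

lemma add_smul_mem_ball {F : Type*} [NormedAddCommGroup F] [NormedSpace ℝ F] {c y v : F} {ρ : ℝ}
    (hy : y ∈ Metric.ball c ρ) (hyv : y + v ∈ Metric.ball c ρ) {t : ℝ} (ht : t ∈ Icc (0 : ℝ) 1) :
    y + t • v ∈ Metric.ball c ρ :=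
  (convex_ball c ρ).add_smul_mem hy hyv ht

lemma IsTransportBall.exists_isSegmentSolution {g : LorentzianMetric m M} {x : M} {ρ : ℝ}
    (h : IsTransportBall g x ρ) {y v : Em} (hy : y ∈ Metric.ball (extChartAt (𝓡 m) x x) ρ)
    (hyv : y + v ∈ Metric.ball (extChartAt (𝓡 m) x x) ρ) : ∃ Φ, IsSegmentSolution g x y v Φ := by
  have hv : ‖v‖ ≤ 2 * ρ := by
    have h1 := dist_triangle_right (y + v) y (extChartAt (𝓡 m) x x)
    rw [dist_eq_norm, add_sub_cancel_left] at h1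
    rw [Metric.mem_ball] at hy hyv
    linarith
  refine exists_fundamental_solution ?_ fun t ht ↦ ?_
  · have h1 : ContinuousOn (fun t : ℝ ↦ christoffelL g x (y + t • v)) (Icc 0 1) :=
      (contDiffOn_christoffelL g x).continuousOn.comp (by fun_prop)
        fun t ht ↦ h.2.1 (add_smul_mem_ball hy hyv ht)
    exact (h1.clm_apply continuousOn_const).neg
  · rw [norm_neg]
    exact h.2.2 _ (add_smul_mem_ball hy hyv ht) v hv

/-- Along a segment in a small ball, parallel transport to every point of the segment is given by
one solution of a linear equation. -/
lemma IsTransportBall.exists_transport {g : LorentzianMetric m M} {x : M} {ρ : ℝ}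
    (h : IsTransportBall g x ρ) {y v : Em} (hy : y ∈ Metric.ball (extChartAt (𝓡 m) x x) ρ)
    (hyv : y + v ∈ Metric.ball (extChartAt (𝓡 m) x x) ρ) :
    ∃ Φ, IsSegmentSolution g x y v Φ ∧ ∀ s ∈ Icc (0 : ℝ) 1,
      ∃ P : TangentSpace (𝓡 m) ((extChartAt (𝓡 m) x).symm y) →ₗ[ℝ]
        TangentSpace (𝓡 m) ((extChartAt (𝓡 m) x).symm (y + s • v)),
      IsParallelTransport g P ∧ ∀ w, chartVector x (P w) = Φ s (chartVector x w) := by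
  obtain ⟨Φ, hΦ⟩ := h.exists_isSegmentSolution hy hyv
  refine ⟨Φ, hΦ, fun s hs ↦ ⟨_, (hΦ.rescale hs).isParallelTransport fun t ht ↦ ?_, fun w ↦ ?_⟩⟩
  · exact h.2.1 (add_smul_mem_ball hy (add_smul_mem_ball hy hyv hs) ht)
  · simp only [mul_one, LinearMap.comp_apply, ContinuousLinearMap.coe_coe, chartVectorL_apply]
    exact chartVector_coordVector x (h.2.1 (add_smul_mem_ball hy hyv hs)) _

/-- On a connected manifold there are parallel transports between any two points. -/
lemma exists_isParallelTransport [ConnectedSpace M] (g : LorentzianMetric m M) (p q : M) :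
    ∃ P : TangentSpace (𝓡 m) p →ₗ[ℝ] TangentSpace (𝓡 m) q, IsParallelTransport g P := by
  let r : M → M → Prop := fun p q ↦
    ∃ P : TangentSpace (𝓡 m) p →ₗ[ℝ] TangentSpace (𝓡 m) q, IsParallelTransport g P
  have htrans : ∀ {a b c}, r a b → r b c → r a c := fun ⟨P, hP⟩ ⟨Q, hQ⟩ ↦ ⟨_, .comp P Q hP hQ⟩
  have hnhds : ∀ x, ∃ U ∈ 𝓝 x, ∀ a ∈ U, ∀ b ∈ U, r a b := by
    intro x
    obtain ⟨ρ, h⟩ := exists_isTransportBall g x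
    refine ⟨(extChartAt (𝓡 m) x).source ∩
      extChartAt (𝓡 m) x ⁻¹' Metric.ball (extChartAt (𝓡 m) x x) ρ,
      Filter.inter_mem (extChartAt_source_mem_nhds x)
        ((continuousAt_extChartAt x).preimage_mem_nhds (Metric.ball_mem_nhds _ h.1)), ?_⟩
    rintro a ⟨ha, ha'⟩ b ⟨hb, hb'⟩
    obtain ⟨Φ, -, hΦ⟩ := h.exists_transport (v := extChartAt (𝓡 m) x b - extChartAt (𝓡 m) x a) ha'
      (by simpa using hb')
    obtain ⟨P, hP, -⟩ := hΦ 1 (by simp)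
    have h1 : r ((extChartAt (𝓡 m) x).symm (extChartAt (𝓡 m) x a)) ((extChartAt (𝓡 m) x).symm
      (extChartAt (𝓡 m) x a + (1 : ℝ) • (extChartAt (𝓡 m) x b - extChartAt (𝓡 m) x a))) := ⟨P, hP⟩
    rwa [one_smul, add_sub_cancel, (extChartAt (𝓡 m) x).left_inv ha,
      (extChartAt (𝓡 m) x).left_inv hb] at h1
  have hclopen : IsClopen {q | r p q} := by
    refine ⟨⟨isOpen_iff_mem_nhds.2 fun x hx ↦ ?_⟩, isOpen_iff_mem_nhds.2 fun x hx ↦ ?_⟩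
    · obtain ⟨U, hU, hr⟩ := hnhds x
      filter_upwards [hU] with a ha
      exact fun hpa ↦ hx (htrans hpa (hr a ha x (mem_of_mem_nhds hU)))
    · obtain ⟨U, hU, hr⟩ := hnhds x
      filter_upwards [hU] with a ha
      exact htrans hx (hr x (mem_of_mem_nhds hU) a ha)
  obtain ⟨U, hU, hr⟩ := hnhds p
  have hp := hr p (mem_of_mem_nhds hU) p (mem_of_mem_nhds hU)
  have huniv := hclopen.eq_univ ⟨p, hp⟩
  exact huniv.ge (mem_univ q)

end Existence

/-! ### Transport-invariant fields are smooth and parallel -/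

section Regularity

/-- `ξ` solves the equation `ξ' = -Γ(v, ξ)` along all segments in `B`, with `v` the velocity. -/
def SolvesAlongSegments {F : Type*} [NormedAddCommGroup F] [NormedSpace ℝ F]
    (Γ : F → F →L[ℝ] F →L[ℝ] F) (ξ : F → F) (B : Set F) : Prop :=
  ∀ y v, y ∈ B → y + v ∈ B → ∀ s ∈ Icc (0 : ℝ) 1,
    HasDerivWithinAt (fun s : ℝ ↦ ξ (y + s • v)) (-Γ (y + s • v) v (ξ (y + s • v))) (Icc 0 1) s

variable {F : Type*} [NormedAddCommGroup F] [NormedSpace ℝ F] {Γ : F → F →L[ℝ] F →L[ℝ] F}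
  {ξ : F → F} {c : F} {ρ : ℝ}

/-- Boundedness, by Grönwall's inequality along the segments from the centre. -/
lemma SolvesAlongSegments.exists_norm_le (h : SolvesAlongSegments Γ ξ (Metric.ball c ρ))
    (hΓ : ∀ y ∈ Metric.ball c ρ, ∀ v, ‖v‖ ≤ 2 * ρ → ‖Γ y v‖ ≤ 1 / 2) :
    ∃ R, 0 < R ∧ ∀ y ∈ Metric.ball c ρ, ‖ξ y‖ ≤ R := by
  refine ⟨max 1 (gronwallBound ‖ξ c‖ (1 / 2) 0 (1 - 0)), by positivity, fun y hy ↦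
    le_max_of_le_right ?_⟩
  have hρ : 0 < ρ := Metric.pos_of_mem_ball hy
  have hc : c ∈ Metric.ball c ρ := Metric.mem_ball_self hρ
  have hv : ‖y - c‖ ≤ 2 * ρ := by
    rw [mem_ball_iff_norm] at hy
    linarith
  have hode := h c (y - c) hc (by simpa using hy)
  have h1 := norm_le_gronwallBound_of_norm_deriv_right_le (δ := ‖ξ c‖) (K := 1 / 2) (ε := 0)
    (fun s hs ↦ (hode s hs).continuousWithinAt)
    (fun s hs ↦ (hode s (Ico_subset_Icc_self hs)).mono_of_mem_nhdsWithin
      (Icc_mem_nhdsGE_of_mem hs)) (by simp) (fun s hs ↦ ?_) 1 (by simp)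
  · simpa using h1
  · rw [norm_neg, add_zero]
    refine (ContinuousLinearMap.le_opNorm _ _).trans ?_
    gcongr
    exact hΓ _ (add_smul_mem_ball hc (by simpa using hy) (Ico_subset_Icc_self hs)) _ hv

/-- Continuity: boundedness of the solution bounds its derivative along short segments. -/
lemma SolvesAlongSegments.continuousAt (h : SolvesAlongSegments Γ ξ (Metric.ball c ρ))
    (hΓ : ∀ y ∈ Metric.ball c ρ, ∀ v, ‖v‖ ≤ 2 * ρ → ‖Γ y v‖ ≤ 1 / 2)
    (hcont : ContinuousOn Γ (Metric.ball c ρ)) {y : F} (hy : y ∈ Metric.ball c ρ) :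
    ContinuousAt ξ y := by
  obtain ⟨R, hR, hξ⟩ := h.exists_norm_le hΓ
  have hΓy : ∀ᶠ z in 𝓝 y, ‖Γ z‖ < ‖Γ y‖ + 1 :=
    (hcont.continuousAt (Metric.isOpen_ball.mem_nhds hy)).norm.eventually_lt continuousAt_const
      (by simp)
  obtain ⟨δ, hδ, hball⟩ := Metric.eventually_nhds_iff_ball.1
    (hΓy.and (Metric.isOpen_ball.mem_nhds hy))
  have hlip : ∀ᶠ z in 𝓝 y, ‖ξ z - ξ y‖ ≤ (‖Γ y‖ + 1) * R * ‖z - y‖ := by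
    filter_upwards [Metric.ball_mem_nhds y hδ] with z hz
    have hode := h y (z - y) hy (by simpa using (hball z hz).2)
    have h1 := norm_image_sub_le_of_norm_deriv_le_segment_01' (C := (‖Γ y‖ + 1) * R * ‖z - y‖) hode
      fun s hs ↦ by
        have hmem := hball _ (add_smul_mem_ball (v := z - y) (Metric.mem_ball_self hδ)
          (by simpa using hz) (Ico_subset_Icc_self hs))
        rw [norm_neg]
        calc _ ≤ ‖Γ (y + s • (z - y))‖ * ‖z - y‖ * ‖ξ (y + s • (z - y))‖ :=
              ContinuousLinearMap.le_opNorm₂ _ _ _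
          _ ≤ (‖Γ y‖ + 1) * ‖z - y‖ * R := by
              gcongr
              · exact hmem.1.le
              · exact hξ _ hmem.2
          _ = _ := by ring
    simpa using h1
  rw [ContinuousAt, tendsto_iff_norm_sub_tendsto_zero]
  refine squeeze_zero' (Filter.Eventually.of_forall fun _ ↦ norm_nonneg _) hlip ?_
  have h2 : Filter.Tendsto (fun z ↦ (‖Γ y‖ + 1) * R * ‖z - y‖) (𝓝 y)
      (𝓝 ((‖Γ y‖ + 1) * R * ‖y - y‖)) := Continuous.tendsto (by fun_prop) y
  simpa using h2

/-- Differentiability: the derivative along the segments from `y` depends continuously on the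
point, so the mean value inequality compares it with its value at `y`. -/
lemma SolvesAlongSegments.hasFDerivAt (h : SolvesAlongSegments Γ ξ (Metric.ball c ρ))
    (hΓ : ∀ y ∈ Metric.ball c ρ, ∀ v, ‖v‖ ≤ 2 * ρ → ‖Γ y v‖ ≤ 1 / 2)
    (hcont : ContinuousOn Γ (Metric.ball c ρ)) {y : F} (hy : y ∈ Metric.ball c ρ) :
    HasFDerivAt ξ (-(Γ y).flip (ξ y)) y := by
  have hD : ContinuousAt (fun y ↦ (Γ y).flip (ξ y)) y := by
    have h1 : ContinuousAt (fun y ↦ (Γ y).flip) y :=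
      (ContinuousLinearMap.flipₗᵢ ℝ F F F).continuous.continuousAt.comp
        (hcont.continuousAt (Metric.isOpen_ball.mem_nhds hy))
    exact h1.clm_apply (h.continuousAt hΓ hcont hy)
  rw [hasFDerivAt_iff_isLittleO, Asymptotics.isLittleO_iff]
  intro ε hε
  have hev : ∀ᶠ z in 𝓝 y, ‖(Γ z).flip (ξ z) - (Γ y).flip (ξ y)‖ < ε := by
    simpa [dist_eq_norm] using hD.eventually (Metric.ball_mem_nhds _ hε)
  obtain ⟨δ, hδ, hball⟩ := Metric.eventually_nhds_iff_ball.1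
    (hev.and (Metric.isOpen_ball.mem_nhds hy))
  filter_upwards [Metric.ball_mem_nhds y hδ] with z hz
  have hode := h y (z - y) hy (by simpa using (hball z hz).2)
  have h1 := norm_image_sub_le_of_norm_deriv_le_segment_01' (C := ε * ‖z - y‖)
    (f := fun s : ℝ ↦ ξ (y + s • (z - y)) + s • (Γ y).flip (ξ y) (z - y))
    (fun s hs ↦ (hode s hs).add ((hasDerivWithinAt_id s (Icc (0 : ℝ) 1)).smul_const
      ((Γ y).flip (ξ y) (z - y)))) fun s hs ↦ by
        have hmem := hball _ (add_smul_mem_ball (v := z - y) (Metric.mem_ball_self hδ)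
          (by simpa using hz) (Ico_subset_Icc_self hs))
        have h2 := ((Γ (y + s • (z - y))).flip (ξ (y + s • (z - y))) -
          (Γ y).flip (ξ y)).le_opNorm (z - y)
        rw [one_smul, ← norm_neg, neg_add, neg_neg, ← sub_eq_add_neg]
        refine h2.trans ?_
        gcongr
        exact hmem.1.le
  simp only [one_smul, zero_smul, add_zero, add_sub_cancel] at h1
  rwa [neg_apply, sub_neg_eq_add, sub_add_eq_add_sub]

/-- Smoothness, by induction from the formula for the derivative. -/
lemma SolvesAlongSegments.contDiffOn [FiniteDimensional ℝ F]
    (h : SolvesAlongSegments Γ ξ (Metric.ball c ρ))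
    (hΓ : ∀ y ∈ Metric.ball c ρ, ∀ v, ‖v‖ ≤ 2 * ρ → ‖Γ y v‖ ≤ 1 / 2)
    (hsmooth : ContDiffOn ℝ ∞ Γ (Metric.ball c ρ)) : ContDiffOn ℝ ∞ ξ (Metric.ball c ρ) := by
  have hd : ∀ y ∈ Metric.ball c ρ, HasFDerivAt ξ (-(Γ y).flip (ξ y)) y := fun y hy ↦
    h.hasFDerivAt hΓ hsmooth.continuousOn hy
  refine contDiffOn_infty.2 fun n ↦ ?_
  induction n with
  | zero => exact contDiffOn_zero.2 fun y hy ↦ (hd y hy).continuousAt.continuousWithinAt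
  | succ n ih =>
    push_cast
    refine (contDiffOn_succ_iff_fderiv_of_isOpen Metric.isOpen_ball).2
      ⟨fun y hy ↦ (hd y hy).differentiableAt.differentiableWithinAt, by simp, ?_⟩
    have h1 : ContDiffOn ℝ n (fun y ↦ -(Γ y).flip (ξ y)) (Metric.ball c ρ) :=
      contDiffOn_clm_apply.2 fun v ↦ (((hsmooth.of_le (by exact_mod_cast le_top)).clm_apply
        contDiffOn_const).clm_apply ih).neg
    exact h1.congr fun y hy ↦ (hd y hy).fderiv

variable {m : ℕ} {M : Type*} [TopologicalSpace M]
  [ChartedSpace (EuclideanSpace ℝ (Fin m)) M] [IsManifold (𝓡 m) ∞ M]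

local notation "Em" => EuclideanSpace ℝ (Fin m)

/-- A vector field that is invariant under all parallel transports is smooth and parallel. -/
lemma isParallelField_of_transport {g : LorentzianMetric m M} {V : ∀ x : M, TangentSpace (𝓡 m) x}
    (hV : ∀ (a b : M) (P : TangentSpace (𝓡 m) a →ₗ[ℝ] TangentSpace (𝓡 m) b),
      IsParallelTransport g P → P (V a) = V b) : IsParallelField g V := by
  have key : ∀ x : M, ∃ ρ, IsTransportBall g x ρ ∧ SolvesAlongSegments (christoffelL g x)
      (fun y ↦ chartVector x (V ((extChartAt (𝓡 m) x).symm y)))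
      (Metric.ball (extChartAt (𝓡 m) x x) ρ) := by
    intro x
    obtain ⟨ρ, h⟩ := exists_isTransportBall g x
    refine ⟨ρ, h, fun y v hy hyv s hs ↦ ?_⟩
    obtain ⟨Φ, hΦ, hP⟩ := h.exists_transport hy hyv
    have heq : ∀ s ∈ Icc (0 : ℝ) 1, chartVector x (V ((extChartAt (𝓡 m) x).symm (y + s • v))) =
        Φ s (chartVector x (V ((extChartAt (𝓡 m) x).symm y))) := by
      intro s hs
      obtain ⟨P, hP1, hP2⟩ := hP s hs
      rw [← hP2, hV _ _ P hP1]
    beta_reduce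
    rw [heq s hs]
    have h1 := (hΦ.2 s hs).clm_apply (hasDerivWithinAt_const s (Icc 0 1)
      (chartVector x (V ((extChartAt (𝓡 m) x).symm y))))
    refine (h1.congr heq (heq s hs)).congr_deriv ?_
    simp
  constructor
  · intro x
    obtain ⟨ρ, h, hs⟩ := key x
    exact contMDiffAt_of_contDiffAt_chartVector V x
      ((hs.contDiffOn h.2.2 ((contDiffOn_christoffelL g x).mono h.2.1)).contDiffAt
        (Metric.ball_mem_nhds _ h.1))
  · intro x v
    obtain ⟨ρ, h, hs⟩ := key x
    have h1 := hs.hasFDerivAt h.2.2 ((contDiffOn_christoffelL g x).mono h.2.1).continuousOn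
      (Metric.mem_ball_self h.1)
    unfold covDeriv
    rw [h1.fderiv, extChartAt_to_inv]
    simp [christoffelL_apply]

/-- On a connected manifold, every vector at `p` fixed by the holonomy group extends to a vector
field that is invariant under parallel transport. -/
lemma exists_transport_invariant_field [ConnectedSpace M] (g : LorentzianMetric m M) {p : M}
    {w : TangentSpace (𝓡 m) p} (hw : ∀ P ∈ Hol g p, P w = w) :
    ∃ V : ∀ x : M, TangentSpace (𝓡 m) x, V p = w ∧
      ∀ (a b : M) (P : TangentSpace (𝓡 m) a →ₗ[ℝ] TangentSpace (𝓡 m) b),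
        IsParallelTransport g P → P (V a) = V b := by
  choose R hR using fun x : M ↦ exists_isParallelTransport g x p
  choose e he using fun x ↦ (hR x).exists_equiv
  -- `R x ∘ P` is a holonomy for every transport `P` from `p` to `x`
  have hfrom : ∀ (x : M) (P : TangentSpace (𝓡 m) p →ₗ[ℝ] TangentSpace (𝓡 m) x),
      IsParallelTransport g P → P w = (e x).symm w := by
    intro x P hP
    rw [LinearEquiv.eq_symm_apply, he]
    exact hw _ (.comp P (R x) hP (hR x))
  refine ⟨fun x ↦ (e x).symm w, ?_, fun a b P hP ↦ ?_⟩
  · change (e p).symm w = w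
    rw [LinearEquiv.symm_apply_eq, he, hw _ (hR p)]
  · obtain ⟨Q, hQ⟩ := exists_isParallelTransport g p a
    change P ((e a).symm w) = (e b).symm w
    rw [← hfrom a Q hQ, ← hfrom b _ (.comp Q P hQ hP)]
    rfl

/-- On a connected manifold, an orthonormal system at `p` of vectors fixed by the holonomy group,
the first of them timelike, extends to parallel vector fields. -/
lemma exists_isParallelOrthonormalSystem [ConnectedSpace M] (g : LorentzianMetric m M) {p : M}
    {k : ℕ} (hk : 1 ≤ k) {w : Fin k → TangentSpace (𝓡 m) p} (hw : IsOrthonormalAt g p w)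
    (htime : IsTimelike g p (w ⟨0, hk⟩)) (hfix : ∀ P ∈ Hol g p, ∀ i, P (w i) = w i) :
    ∃ V : Fin k → ∀ x : M, TangentSpace (𝓡 m) x, IsParallelOrthonormalSystem g hk V := by
  choose V hVp hV using fun i ↦ exists_transport_invariant_field g (w := w i)
    fun P hP ↦ hfix P hP i
  have hval : ∀ x i j, g.val x (V i x) (V j x) = g.val p (w i) (w j) := by
    intro x i j
    obtain ⟨P, hP⟩ := exists_isParallelTransport g p x
    rw [← hV i p x P hP, ← hV j p x P hP, hP.val_eq, hVp, hVp]
  refine ⟨V, fun i ↦ isParallelField_of_transport (hV i), fun x ↦ ⟨fun i ↦ ?_, fun i j hij ↦ ?_⟩,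
    fun x ↦ ?_⟩
  · rw [hval, hw.1]
  · rw [hval, hw.2 i j hij]
  · rw [IsTimelike, hval]
    exact htime

end Regularity

/-! ### Adapted bases -/

section AdaptedBases

variable {V : Type*} [AddCommGroup V] [Module ℝ V] [FiniteDimensional ℝ V]

/-- The vectors orthogonal to a family of vectors. -/
def orthogonalTo (B : LinearMap.BilinForm ℝ V) {ι : Type*} (e : ι → V) : Submodule ℝ V :=
  LinearMap.ker (LinearMap.pi fun i ↦ B (e i))

lemma mem_orthogonalTo {B : LinearMap.BilinForm ℝ V} {ι : Type*} {e : ι → V} {v : V} :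
    v ∈ orthogonalTo B e ↔ ∀ i, B (e i) v = 0 := by
  simp [orthogonalTo, funext_iff]

lemma le_finrank_orthogonalTo (B : LinearMap.BilinForm ℝ V) {k : ℕ} (e : Fin k → V) :
    Module.finrank ℝ V ≤ Module.finrank ℝ (orthogonalTo B e) + k := by
  have h1 := LinearMap.finrank_range_add_finrank_ker (LinearMap.pi fun i ↦ B (e i))
  have h2 := Submodule.finrank_le (LinearMap.range (LinearMap.pi fun i ↦ B (e i)))
  rw [Module.finrank_fin_fun] at h2
  unfold orthogonalTo
  omega

/-- An orthonormal system whose first vector is timelike is part of an orthonormal basis whose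
other vectors are spacelike. -/
lemma IsLorentzForm.exists_adapted_basis {B : LinearMap.BilinForm ℝ V} (hB : IsLorentzForm B)
    {k : ℕ} (hk : 1 ≤ k) (hkV : k ≤ Module.finrank ℝ V) {e : Fin k → V}
    (h1 : ∀ i, |B (e i) (e i)| = 1) (h2 : ∀ i j, i ≠ j → B (e i) (e j) = 0)
    (h3 : B (e ⟨0, hk⟩) (e ⟨0, hk⟩) < 0) :
    ∃ b : Module.Basis (Fin k ⊕ Fin (Module.finrank ℝ V - k)) ℝ V,
      (∀ i, b (Sum.inl i) = e i) ∧ (∀ i j, i ≠ j → B (b i) (b j) = 0) ∧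
        ∀ j, B (b (Sum.inr j)) (b (Sum.inr j)) = 1 := by
  obtain ⟨f, hfW, hf⟩ := exists_orthonormal_of_posDef hB.1 (orthogonalTo B e)
    (fun w hw hw0 ↦ hB.pos_of_orthogonal h3 (mem_orthogonalTo.1 hw _) hw0)
    (n := Module.finrank ℝ V - k) (by have := le_finrank_orthogonalTo B e; omega)
  have hef : ∀ i j, B (e i) (f j) = 0 := fun i j ↦ mem_orthogonalTo.1 (hfW j) i
  have horth : ∀ i j, i ≠ j → B (Sum.elim e f i) (Sum.elim e f j) = 0 := by
    rintro (i | i) (j | j) hij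
    · exact h2 i j fun h ↦ hij (by rw [h])
    · exact hef i j
    · exact (hB.1 _ _).trans (hef j i)
    · exact (hf i j).trans (if_neg fun h ↦ hij (by rw [h]))
  have hne : ∀ i, B (Sum.elim e f i) (Sum.elim e f i) ≠ 0 := by
    rintro (i | i) h
    · have := h1 i
      simp only [Sum.elim_inl] at h
      simp [h] at this
    · simp [hf] at h
  have hli := linearIndependent_of_orthogonal horth hne
  let b := Module.Basis.mk hli (hli.span_eq_top_of_card_eq_finrank' (by simp; omega)).ge
  have hb : ∀ i, b i = Sum.elim e f i := fun i ↦ Module.Basis.mk_apply _ _ i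
  exact ⟨b, fun i ↦ hb _, fun i j hij ↦ by rw [hb, hb, horth i j hij], fun j ↦ by simp [hb, hf]⟩

/-- A subspace of dimension at least `k` containing a timelike vector contains an orthonormal system
of `k` vectors, the first of them timelike. -/
lemma IsLorentzForm.exists_orthonormal_system {B : LinearMap.BilinForm ℝ V} (hB : IsLorentzForm B)
    {k : ℕ} (hk : 1 ≤ k) (W : Submodule ℝ V) (hkW : k ≤ Module.finrank ℝ W) {u : V} (huW : u ∈ W)
    (hu : B u u < 0) :
    ∃ w : Fin k → V, (∀ i, w i ∈ W) ∧ (∀ i, |B (w i) (w i)| = 1) ∧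
      (∀ i j, i ≠ j → B (w i) (w j) = 0) ∧ B (w ⟨0, hk⟩) (w ⟨0, hk⟩) < 0 := by
  obtain ⟨n, rfl⟩ := Nat.exists_eq_add_of_le' hk
  have hdim : n ≤ Module.finrank ℝ (W ⊓ orthogonalTo B (fun _ : Fin 1 ↦ u) : Submodule ℝ V) := by
    have h1 := le_finrank_orthogonalTo B (fun _ : Fin 1 ↦ u)
    have h2 := Submodule.finrank_sup_add_finrank_inf_eq W (orthogonalTo B (fun _ : Fin 1 ↦ u))
    have h3 := Submodule.finrank_le (W ⊔ orthogonalTo B (fun _ : Fin 1 ↦ u))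
    omega
  obtain ⟨f, hfW, hf⟩ := exists_orthonormal_of_posDef hB.1
    (W ⊓ orthogonalTo B (fun _ : Fin 1 ↦ u))
    (fun w hw hw0 ↦ hB.pos_of_orthogonal hu (mem_orthogonalTo.1 hw.2 0) hw0) hdim
  have huf : ∀ j, B u (f j) = 0 := fun j ↦ mem_orthogonalTo.1 (hfW j).2 0
  have hnorm : B ((√(-B u u))⁻¹ • u) ((√(-B u u))⁻¹ • u) = -1 := by
    have h1 := Real.mul_self_sqrt (neg_pos.2 hu).le
    have h2 := (Real.sqrt_pos.2 (neg_pos.2 hu)).ne'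
    simp only [map_smul, LinearMap.smul_apply, smul_eq_mul]
    field_simp
    linarith
  refine ⟨Fin.cons ((√(-B u u))⁻¹ • u) f, ?_, ?_, ?_, hnorm.trans_lt (by norm_num)⟩
  · exact Fin.cases (W.smul_mem _ huW) fun j ↦ (hfW j).1
  · refine Fin.cases ?_ fun j ↦ ?_
    · rw [Fin.cons_zero, hnorm]
      simp
    · simp [hf]
  · refine Fin.cases (Fin.cases (fun h ↦ (h rfl).elim) fun j _ ↦ ?_)
      fun i ↦ Fin.cases (fun _ ↦ ?_) fun j hij ↦ ?_
    · simp [huf]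
    · simp [hB.1 (f i) u, huf]
    · simp only [Fin.cons_succ, hf]
      exact if_neg fun h ↦ hij (by rw [h])

end AdaptedBases

/-! ### Holonomy and parallel orthonormal systems -/

section Holonomy

variable {m : ℕ} {M : Type*} [TopologicalSpace M]
  [ChartedSpace (EuclideanSpace ℝ (Fin m)) M] [IsManifold (𝓡 m) ∞ M]

/-- If the holonomy group is contained in `SO(m - k)` in some basis, then it fixes an orthonormal
system of `k` vectors, the first of them timelike. -/
lemma HolInSO.exists_fixed_system {g : LorentzianMetric m M}
    {C : ∀ x : M, Set (TangentSpace (𝓡 m) x)} (hC : IsTimeOrientation g C) {p : M} {k n : ℕ}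
    (hk : 1 ≤ k) {b : Module.Basis (Fin k ⊕ Fin n) ℝ (TangentSpace (𝓡 m) p)}
    (h : HolInSO g p b) :
    ∃ w : Fin k → TangentSpace (𝓡 m) p, IsOrthonormalAt g p w ∧ IsTimelike g p (w ⟨0, hk⟩) ∧
      ∀ P ∈ Hol g p, ∀ i, P (w i) = w i := by
  obtain ⟨U, hU, T, -, hT⟩ := hC p
  obtain ⟨hT0, hCp⟩ := hT p (mem_of_mem_nhds hU)
  have hfix : ∀ P ∈ Hol g p, ∀ i, P (b (Sum.inl i)) = b (Sum.inl i) := by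
    intro P hP i
    obtain ⟨A, -, hA⟩ := h P hP
    refine b.repr.injective (Finsupp.ext fun j ↦ ?_)
    rw [← LinearMap.toMatrix_apply b b, hA, b.repr_self]
    rcases j with j | j
    · simp [Matrix.one_apply, Finsupp.single_apply, eq_comm]
    · simp
  obtain ⟨u, hu, hPu⟩ := exists_timelike_fixed (g.isLorentzForm p) b (Hol g p)
    (fun P hP ↦ by
      obtain ⟨A, hA, hPA⟩ := h P hP
      have h1 := (Matrix.mem_orthogonalGroup_iff' _ _).1
        (Matrix.mem_specialOrthogonalGroup_iff.1 hA).1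
      rw [hPA, Matrix.mem_orthogonalGroup_iff', Matrix.fromBlocks_transpose,
        Matrix.fromBlocks_multiply]
      simp [h1])
    (fun P hP v w ↦ IsParallelTransport.val_eq hP v w) (t := T p) hT0
    (fun P hP v hv hvT ↦ by
      have h1 : P v ∈ C p := IsParallelTransport.mem_cone hC hP (by rw [hCp]; exact ⟨hv, hvT⟩)
      rw [hCp] at h1
      exact h1.2)
  let W : Submodule ℝ (TangentSpace (𝓡 m) p) :=
    ⨅ P ∈ Hol g p, LinearMap.eqLocus P LinearMap.id
  have hW : ∀ v, v ∈ W ↔ ∀ P ∈ Hol g p, P v = v := by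
    intro v
    simp [W, Submodule.mem_iInf]
  have hkW : k ≤ Module.finrank ℝ W := by
    let f : Fin k → W := fun i ↦ ⟨b (Sum.inl i), (hW _).2 fun P hP ↦ hfix P hP i⟩
    have hf : LinearIndependent ℝ f :=
      LinearIndependent.of_comp W.subtype (b.linearIndependent.comp _ Sum.inl_injective)
    simpa using hf.fintype_card_le_finrank
  obtain ⟨w, hwW, h1, h2, h3⟩ := (g.isLorentzForm p).exists_orthonormal_system hk W hkW
    ((hW u).2 hPu) hu
  exact ⟨w, ⟨h1, h2⟩, h3, fun P hP i ↦ (hW _).1 (hwW i) P hP⟩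

/-- The values at `p` of a parallel orthonormal system extend to an orthonormal basis in which the
holonomy group is contained in `SO(m - k)`. -/
lemma IsParallelOrthonormalSystem.exists_basis {g : LorentzianMetric m M}
    {o : ∀ x : M, _root_.Orientation ℝ (TangentSpace (𝓡 m) x) (Fin m)} (ho : IsOrientation o)
    {k : ℕ} (hk : 1 ≤ k) (hkm : k ≤ m) {V : Fin k → ∀ x : M, TangentSpace (𝓡 m) x}
    (hV : IsParallelOrthonormalSystem g hk V) (p : M) :
    ∃ b : Module.Basis (Fin k ⊕ Fin (m - k)) ℝ (TangentSpace (𝓡 m) p),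
      IsOrthonormalAt g p b ∧ IsTimelike g p (b (Sum.inl ⟨0, hk⟩)) ∧ HolInSO g p b := by
  obtain ⟨hpar, horth, htime⟩ := hV
  have hex := (g.isLorentzForm p).exists_adapted_basis hk
    (by rwa [finrank_tangentSpace]) (horth p).1 (horth p).2 (htime p)
  rw [finrank_tangentSpace] at hex
  obtain ⟨b, hbV, hb, hb1⟩ := hex
  have habs : ∀ i, |g.val p (b i) (b i)| = 1 := by
    rintro (i | i)
    · rw [hbV]
      exact (horth p).1 i
    · exact (congrArg abs (hb1 i)).trans abs_one
  refine ⟨b, ⟨habs, hb⟩, by rw [hbV]; exact htime p, fun P hP ↦ ?_⟩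
  refine exists_specialOrthogonal_of_isometry (B := g.form p) b hb (fun i h ↦ ?_) hb1
    (fun v w ↦ IsParallelTransport.val_eq hP v w) (fun i ↦ ?_) (IsParallelTransport.det_pos ho hP)
  · have h1 := habs i
    rw [← g.form_apply, h] at h1
    simp at h1
  · rw [hbV]
    exact IsParallelTransport.apply_field hP (hpar i)

end Holonomy

end Lorentzian

end

theorem theorem2 {m : ℕ} {M : Type*} [TopologicalSpace M]
    [ChartedSpace (EuclideanSpace ℝ (Fin m)) M] [IsManifold (𝓡 m) ∞ M]
    [T2Space M] [SecondCountableTopology M] [ConnectedSpace M]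
    (g : Lorentzian.LorentzianMetric m M)
    (o : ∀ x : M, Orientation ℝ (TangentSpace (𝓡 m) x) (Fin m))
    (ho : Lorentzian.IsOrientation o)
    (C : ∀ x : M, Set (TangentSpace (𝓡 m) x))
    (hC : Lorentzian.IsTimeOrientation g C)
    (k : ℕ) (hk : 1 ≤ k) (hkm : k ≤ m) (p : M) :
    ((∃ b : Module.Basis (Fin k ⊕ Fin (m - k)) ℝ (TangentSpace (𝓡 m) p),
        Lorentzian.HolInSO g p b) ↔
      ∃ V : Fin k → ∀ x : M, TangentSpace (𝓡 m) x,
        Lorentzian.IsParallelOrthonormalSystem g hk V) ∧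
    ((∃ b : Module.Basis (Fin k ⊕ Fin (m - k)) ℝ (TangentSpace (𝓡 m) p),
        Lorentzian.IsOrthonormalAt g p b ∧
        Lorentzian.IsTimelike g p (b (Sum.inl ⟨0, hk⟩)) ∧
        Lorentzian.HolInSO g p b) ↔
      ∃ V : Fin k → ∀ x : M, TangentSpace (𝓡 m) x,
        Lorentzian.IsParallelOrthonormalSystem g hk V) := by
  have hto : ∀ b : Module.Basis (Fin k ⊕ Fin (m - k)) ℝ (TangentSpace (𝓡 m) p),
      Lorentzian.HolInSO g p b → ∃ V : Fin k → ∀ x : M, TangentSpace (𝓡 m) x,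
        Lorentzian.IsParallelOrthonormalSystem g hk V := fun b hb ↦ by
    obtain ⟨w, hw, htime, hfix⟩ := hb.exists_fixed_system hC hk
    exact Lorentzian.exists_isParallelOrthonormalSystem g hk hw htime hfix
  refine ⟨⟨fun ⟨b, hb⟩ ↦ hto b hb, fun ⟨V, hV⟩ ↦ ?_⟩,
    ⟨fun ⟨b, _, _, hb⟩ ↦ hto b hb, fun ⟨V, hV⟩ ↦ hV.exists_basis ho hk hkm p⟩⟩
  obtain ⟨b, -, -, hb⟩ := hV.exists_basis ho hk hkm p
  exact ⟨b, hb⟩
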